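/- Let $\Phi$ be a commutative ring with $\tfrac16\in\Phi$ and let $T$ be a strongly nondegenerate Jordan triple system over $\Phi$, with triple product $\{x,y,z\}$ (strongly nondegenerate: $\{x,T,x\}=0$ implies $x=0$). **Triple systems of quotients.** An ideal of $T$ is a submodule $I$ with $\{I,T,T\}+\{T,I,T\}+\{T,T,I\}\subseteq I$; its annihilator is $\mathrm{Ann}_T(I)=\{z\in T:\{z,I,T\}=\{z,T,I\}=\{T,z,I\}=0\}$. A Jordan triple system $W$ containing $T$ as a subsystem is a Jordan triple system of $\mathfrak M$-quotients of $T$ if for each $0\ne q\in W$ there is an ideal $I$ of $T$ with $\mathrm{Ann}_T(I)=0$ such that $\{q,I,T\}$, $\{q,T,I\}$ and $\{I,q,T\}$ are contained in $T$ and are not all zero. A Jordan triple system of $\mathfrak M$-quotients $Q$ of $T$ is *maximal* if every Jordan triple system $W$ of $\mathfrak M$-quotients of $T$ admits a unique homomorphism $W\to Q$ that is the identity on $T$, and this homomorphism is injective. **The Lie algebra.** Let $V(T)=(T,T)$ be the double Jordan pair of $T$, and let $L=\mathrm{TKK}(V(T))=T\oplus\mathrm{IDer}(V(T))\oplus T$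 be its Tits–Kantor–Koecher algebra, graded by $L_1=T$, $L_0=\mathrm{IDer}(V(T))$, $L_{-1}=T$. The Lie algebra $L$ is semiprime; let $Q_m(L)=\varinjlim \mathrm{Der}(I,L)$ be its maximal algebra of quotients, the direct limit, over the essential ideals $I$ of $L$, of the modules of derivations $\delta:I\to L$, with bracket induced by $\delta\mu-\mu\delta$. Let $Q_m(L)_1$ be the set of classes of derivations of degree $1$ defined on graded essential ideals of $L$, and let $\tau$ be the automorphism of $Q_m(L)$ induced by the exchange automorphism $x\oplus(\gamma_+,\gamma_-)\oplus y\mapsto y\oplus(\gamma_-,\gamma_+)\oplus x$ of $L$. **Theorem.** The module $Q_m(L)_1$ with the product $\{p,q,r\}=[[p,\tau(q)],r]$ is a Jordan triple system, and, with $T=L_1$ embedded by $x\mapsto \mathrm{ad}\,x$, it is the maximal Jordan triple system of $\mathfrak M$-quotients of $T$. That is, $$Q_m(T)=\bigl(Q_m(\mathrm{TKK}(V(T)))\bigr)_1 .$$ -/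

import Mathlib

universe u v w x

/-! ### Algebras of quotients of Lie algebras -/

namespace LieQuot

section Basic

variable {Φ L : Type*} [CommRing Φ] [LieRing L] [LieAlgebra Φ L]

/-- An ideal is essential if it meets every nonzero ideal nontrivially. -/
def IsEssential (I : LieIdeal Φ L) : Prop :=
  ∀ J : LieIdeal Φ L, J ≠ ⊥ → I ⊓ J ≠ ⊥

variable (Φ L) in
/-- A Lie algebra is semiprime if `[I, I] ≠ 0` for every nonzero ideal `I`. -/
class Semiprime : Prop where
  lie_self_ne_bot : ∀ I : LieIdeal Φ L, I ≠ ⊥ → ⁅I, I⁆ ≠ ⊥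

theorem IsEssential.top : IsEssential (⊤ : LieIdeal Φ L) := by
  intro J hJ
  rwa [top_inf_eq]

theorem IsEssential.inf {I J : LieIdeal Φ L} (hI : IsEssential I) (hJ : IsEssential J) :
    IsEssential (I ⊓ J) := by
  intro K hK
  rw [inf_assoc]
  exact hI _ (hJ K hK)

theorem IsEssential.lie_self [Semiprime Φ L] {I : LieIdeal Φ L} (hI : IsEssential I) :
    IsEssential ⁅I, I⁆ := by
  intro J hJ h
  refine Semiprime.lie_self_ne_bot (Φ := Φ) (L := L) (I ⊓ J) (hI J hJ) (le_bot_iff.mp ?_)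
  rw [← h]
  exact le_inf (LieSubmodule.mono_lie inf_le_left inf_le_left)
    ((LieSubmodule.mono_lie inf_le_right inf_le_right).trans (LieSubmodule.lie_le_right _ _))

/-- The `Φ`-module `Der(I, L)` of derivations from the ideal `I` into `L`. -/
def PDer (I : LieIdeal Φ L) : Submodule Φ (I →ₗ[Φ] L) where
  carrier := {δ | ∀ x y : I, δ ⁅x, y⁆ = ⁅δ x, (y : L)⁆ + ⁅(x : L), δ y⁆}
  add_mem' := by
    intro a b ha hb x y
    simp only [LinearMap.add_apply, ha x y, hb x y, add_lie, lie_add]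
    abel
  zero_mem' := by
    intro x y
    simp
  smul_mem' := by
    intro c a ha x y
    simp only [LinearMap.smul_apply, ha x y, smul_lie, lie_smul, smul_add]

/-- Restriction of a derivation to a smaller ideal. -/
def PDer.restrict {I J : LieIdeal Φ L} (h : J ≤ I) : PDer I →ₗ[Φ] PDer J where
  toFun δ := ⟨δ.1.comp (LieSubmodule.inclusion h : J →ₗ[Φ] I), fun x y =>
    δ.2 (LieSubmodule.inclusion h x) (LieSubmodule.inclusion h y)⟩
  map_add' _ _ := rfl
  map_smul' _ _ := rfl

theorem PDer.apply_lie {I : LieIdeal Φ L} (δ : PDer I) {x y : L} (hx : x ∈ I) (hy : y ∈ I)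
    (h : ⁅x, y⁆ ∈ I) : δ.1 ⟨⁅x, y⁆, h⟩ = ⁅δ.1 ⟨x, hx⟩, y⁆ + ⁅x, δ.1 ⟨y, hy⟩⁆ :=
  δ.2 ⟨x, hx⟩ ⟨y, hy⟩

theorem PDer.apply_mem {I : LieIdeal Φ L} (δ : PDer I) {x : L} (hx : x ∈ ⁅I, I⁆) (hx' : x ∈ I) :
    δ.1 ⟨x, hx'⟩ ∈ I := by
  have key : (⁅I, I⁆ : LieIdeal Φ L).toSubmodule ≤
      (I.toSubmodule.comap δ.1).map I.toSubmodule.subtype := by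
    rw [LieSubmodule.lieIdeal_oper_eq_linear_span', Submodule.span_le]
    rintro _ ⟨a, ha, b, hb, rfl⟩
    refine ⟨⟨⁅a, b⁆, lie_mem_right Φ L I a b hb⟩, ?_, rfl⟩
    change δ.1 ⟨⁅a, b⁆, _⟩ ∈ I
    rw [PDer.apply_lie δ ha hb]
    exact add_mem (lie_mem_right Φ L I _ _ hb) (lie_mem_left Φ L I _ _ ha)
  obtain ⟨y, hy, rfl⟩ := key hx
  exact hy

theorem lie_self_le (I : LieIdeal Φ L) : ⁅I, I⁆ ≤ I := LieSubmodule.lie_le_right I I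

/-- The composite `δ ∘ μ`, defined on `[I, I]`. -/
def PDer.compSq {I : LieIdeal Φ L} (δ μ : PDer I) : (⁅I, I⁆ : LieIdeal Φ L) →ₗ[Φ] L where
  toFun x := δ.1 ⟨μ.1 ⟨x, lie_self_le I x.2⟩, PDer.apply_mem μ x.2 _⟩
  map_add' x y := by
    rw [← map_add]
    congr 1
    exact Subtype.ext (map_add μ.1 ⟨x, lie_self_le I x.2⟩ ⟨y, lie_self_le I y.2⟩)
  map_smul' c x := by
    rw [RingHom.id_apply, ← map_smul]
    congr 1
    exact Subtype.ext (map_smul μ.1 c ⟨x, lie_self_le I x.2⟩)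

theorem PDer.compSq_apply {I : LieIdeal Φ L} (δ μ : PDer I) (x : L) (hx : x ∈ ⁅I, I⁆) :
    PDer.compSq δ μ ⟨x, hx⟩ = δ.1 ⟨μ.1 ⟨x, lie_self_le I hx⟩, PDer.apply_mem μ hx _⟩ := rfl

theorem PDer.compSq_lie {I : LieIdeal Φ L} (δ μ : PDer I) (x y : (⁅I, I⁆ : LieIdeal Φ L)) :
    PDer.compSq δ μ ⁅x, y⁆ = ⁅PDer.compSq δ μ x, (y : L)⁆ +
      ⁅μ.1 ⟨x, lie_self_le I x.2⟩, δ.1 ⟨y, lie_self_le I y.2⟩⁆ +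
      ⁅δ.1 ⟨x, lie_self_le I x.2⟩, μ.1 ⟨y, lie_self_le I y.2⟩⁆ + ⁅(x : L), PDer.compSq δ μ y⁆ := by
  obtain ⟨x, hx⟩ := x
  obtain ⟨y, hy⟩ := y
  have hxI := lie_self_le I hx
  have hyI := lie_self_le I hy
  have h1 : (⟨μ.1 ⟨⁅x, y⁆, lie_mem_right Φ L I x y hyI⟩,
        PDer.apply_mem μ (lie_mem_right Φ L _ x y hy) _⟩ : I) =
      ⟨⁅μ.1 ⟨x, hxI⟩, y⁆, lie_mem_right Φ L I _ _ hyI⟩ +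
      ⟨⁅x, μ.1 ⟨y, hyI⟩⁆, lie_mem_left Φ L I _ _ hxI⟩ :=
    Subtype.ext (PDer.apply_lie μ hxI hyI _)
  change δ.1 ⟨μ.1 ⟨⁅x, y⁆, _⟩, _⟩ = _
  rw [h1, map_add, PDer.apply_lie δ (PDer.apply_mem μ hx hxI) hyI, PDer.apply_lie δ hxI (PDer.apply_mem μ hy hyI)]
  simp only [PDer.compSq_apply]
  abel

/-- The bracket `δ ∘ μ - μ ∘ δ` of two derivations defined on `I`; it is defined on `[I, I]`. -/
def PDer.bracket {I : LieIdeal Φ L} (δ μ : PDer I) : PDer ⁅I, I⁆ :=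
  ⟨PDer.compSq δ μ - PDer.compSq μ δ, fun x y => by
    simp only [LinearMap.sub_apply, PDer.compSq_lie, sub_lie, lie_sub]
    abel⟩

theorem PDer.bracket_apply {I : LieIdeal Φ L} (δ μ : PDer I) (x : L) (hx : x ∈ ⁅I, I⁆) :
    (PDer.bracket δ μ).1 ⟨x, hx⟩ = δ.1 ⟨μ.1 ⟨x, lie_self_le I hx⟩, PDer.apply_mem μ hx _⟩ -
      μ.1 ⟨δ.1 ⟨x, lie_self_le I hx⟩, PDer.apply_mem δ hx _⟩ := rfl

theorem PDer.restrict_apply {I J : LieIdeal Φ L} (h : J ≤ I) (δ : PDer I) (x : L) (hx : x ∈ J) :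
    (PDer.restrict h δ).1 ⟨x, hx⟩ = δ.1 ⟨x, h hx⟩ := rfl

theorem PDer.ext' {I : LieIdeal Φ L} {δ μ : PDer I}
    (h : ∀ (x : L) (hx : x ∈ I), δ.1 ⟨x, hx⟩ = μ.1 ⟨x, hx⟩) : δ = μ :=
  Subtype.ext (LinearMap.ext fun x => h x.1 x.2)

variable (Φ L) in
/-- The essential ideals of `L`, ordered by reverse inclusion. -/
abbrev EssIdeal : Type _ := {I : LieIdeal Φ L // IsEssential I}ᵒᵈ

instance : Nonempty (EssIdeal Φ L) := ⟨OrderDual.toDual ⟨⊤, IsEssential.top⟩⟩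

instance : IsDirectedOrder (EssIdeal Φ L) :=
  ⟨fun I J => ⟨OrderDual.toDual ⟨_, (OrderDual.ofDual I).2.inf (OrderDual.ofDual J).2⟩,
    inf_le_left (a := (OrderDual.ofDual I).1), inf_le_right (b := (OrderDual.ofDual J).1)⟩⟩

/-- `Der(I, L)` as a system indexed by the essential ideals. -/
abbrev derSystem (I : EssIdeal Φ L) : Type _ := PDer (OrderDual.ofDual I).1

/-- The transition maps of the system: restriction. -/
abbrev derSystemMap (I J : EssIdeal Φ L) (h : I ≤ J) : derSystem I →ₗ[Φ] derSystem J :=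
  PDer.restrict (I := (OrderDual.ofDual I).1) (J := (OrderDual.ofDual J).1) h

instance : DirectedSystem (derSystem (Φ := Φ) (L := L)) (derSystemMap · · ·) where
  map_self _ _ := rfl
  map_map _ _ _ _ _ _ := rfl

variable (Φ L) in
/-- The maximal algebra of quotients `Q_m(L) = lim Der(I, L)`, the direct limit over the essential
ideals `I` of `L`. -/
def Qm : Type _ :=
  DirectLimit (derSystem (Φ := Φ) (L := L)) (derSystemMap (Φ := Φ) (L := L))

noncomputable instance : AddCommGroup (Qm Φ L) :=
  inferInstanceAs (AddCommGroup
    (DirectLimit (derSystem (Φ := Φ) (L := L)) (derSystemMap (Φ := Φ) (L := L))))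

noncomputable instance : Module Φ (Qm Φ L) :=
  inferInstanceAs (Module Φ
    (DirectLimit (derSystem (Φ := Φ) (L := L)) (derSystemMap (Φ := Φ) (L := L))))

/-- The class in `Q_m(L)` of a derivation `δ : I → L` defined on an essential ideal `I`. -/
def Qm.mk {I : LieIdeal Φ L} (hI : IsEssential I) (δ : PDer I) : Qm Φ L :=
  Quotient.mk (DirectLimit.setoid (derSystemMap (Φ := Φ) (L := L)))
    ⟨OrderDual.toDual ⟨I, hI⟩, δ⟩

theorem Qm.sound {I J K : LieIdeal Φ L} (hI : IsEssential I) (hJ : IsEssential J)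
    (hK : IsEssential K) (hKI : K ≤ I) (hKJ : K ≤ J) (δ : PDer I) (μ : PDer J)
    (h : ∀ (x : L) (hx : x ∈ K), δ.1 ⟨x, hKI hx⟩ = μ.1 ⟨x, hKJ hx⟩) :
    Qm.mk hI δ = Qm.mk hJ μ :=
  Quotient.sound ⟨OrderDual.toDual ⟨K, hK⟩, hKI, hKJ, PDer.ext' fun x hx => h x hx⟩

theorem Qm.mk_restrict {I J : LieIdeal Φ L} (hI : IsEssential I) (hJ : IsEssential J)
    (h : J ≤ I) (δ : PDer I) : Qm.mk hJ (PDer.restrict h δ) = Qm.mk hI δ :=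
  Qm.sound hJ hI hJ le_rfl h _ _ fun _ _ => rfl

theorem Qm.mk_add {I : LieIdeal Φ L} (hI : IsEssential I) (δ μ : PDer I) :
    Qm.mk hI (δ + μ) = Qm.mk hI δ + Qm.mk hI μ :=
  (DirectLimit.add_def (G := derSystem (Φ := Φ) (L := L)) (f := derSystemMap (Φ := Φ) (L := L))
    (OrderDual.toDual ⟨I, hI⟩) δ μ).symm

theorem Qm.mk_zero {I : LieIdeal Φ L} (hI : IsEssential I) : Qm.mk hI 0 = 0 :=
  (DirectLimit.zero_def (G := derSystem (Φ := Φ) (L := L)) (f := derSystemMap (Φ := Φ) (L := L)) (OrderDual.toDual ⟨I, hI⟩)).symm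

theorem Qm.mk_smul {I : LieIdeal Φ L} (hI : IsEssential I) (c : Φ) (δ : PDer I) :
    Qm.mk hI (c • δ) = c • Qm.mk hI δ := rfl

theorem Qm.ind₃ {P : Qm Φ L → Qm Φ L → Qm Φ L → Prop}
    (h : ∀ (I : LieIdeal Φ L) (hI : IsEssential I) (a b c : PDer I),
      P (Qm.mk hI a) (Qm.mk hI b) (Qm.mk hI c)) (p q r : Qm Φ L) : P p q r :=
  DirectLimit.induction₃ (derSystemMap (Φ := Φ) (L := L))
    (C := fun p q r : Qm Φ L => P p q r)
    (fun i x y z => h (OrderDual.ofDual i).1 (OrderDual.ofDual i).2 x y z) p q r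

theorem PDer.restrict_bracket {I J : LieIdeal Φ L} (h : J ≤ I) (δ μ : PDer I) :
    PDer.restrict (LieSubmodule.mono_lie h h) (PDer.bracket δ μ) =
      PDer.bracket (PDer.restrict h δ) (PDer.restrict h μ) := rfl

/-- The bracket `[δ_I, μ_J] = (δμ - μδ)_{[K, K]}`, `K = I ∩ J`. -/
noncomputable instance [Semiprime Φ L] : Bracket (Qm Φ L) (Qm Φ L) where
  bracket := DirectLimit.lift₂ (derSystemMap (Φ := Φ) (L := L)) (derSystemMap (Φ := Φ) (L := L))
    (fun I δ μ => Qm.mk (OrderDual.ofDual I).2.lie_self (PDer.bracket δ μ))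
    (fun I J h δ μ =>
       (Qm.mk_restrict (OrderDual.ofDual I).2.lie_self (OrderDual.ofDual J).2.lie_self
        (LieSubmodule.mono_lie h h) (PDer.bracket δ μ)).symm)

theorem Qm.mk_lie [Semiprime Φ L] {I : LieIdeal Φ L} (hI : IsEssential I) (δ μ : PDer I) :
    ⁅Qm.mk hI δ, Qm.mk hI μ⁆ = Qm.mk hI.lie_self (PDer.bracket δ μ) :=
  DirectLimit.lift₂_def (derSystemMap (Φ := Φ) (L := L)) (derSystemMap (Φ := Φ) (L := L))
    (fun I δ μ => Qm.mk (OrderDual.ofDual I).2.lie_self (PDer.bracket δ μ)) _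
    (OrderDual.toDual ⟨I, hI⟩) δ μ

theorem PDer.bracket_add_left {I : LieIdeal Φ L} (a b c : PDer I) :
    PDer.bracket (a + b) c = PDer.bracket a c + PDer.bracket b c := by
  refine PDer.ext' fun x hx => ?_
  have h : (⟨(a + b).1 ⟨x, lie_self_le I hx⟩, PDer.apply_mem (a + b) hx _⟩ : I) =
    ⟨a.1 ⟨x, lie_self_le I hx⟩, PDer.apply_mem a hx _⟩ + ⟨b.1 ⟨x, lie_self_le I hx⟩, PDer.apply_mem b hx _⟩ :=
    rfl
  change (a + b).1 _ - c.1 ⟨(a + b).1 ⟨x, lie_self_le I hx⟩, _⟩ =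
    (a.1 _ - c.1 _) + (b.1 _ - c.1 _)
  rw [h, map_add]
  change (a.1 _ + b.1 _) - (_ + _) = _
  abel

theorem PDer.bracket_skew {I : LieIdeal Φ L} (a b : PDer I) :
    PDer.bracket a b = - PDer.bracket b a := by
  refine PDer.ext' fun x hx => ?_
  change a.1 _ - b.1 _ = - (b.1 _ - a.1 _)
  abel

theorem PDer.bracket_smul {I : LieIdeal Φ L} (t : Φ) (a b : PDer I) :
    PDer.bracket a (t • b) = t • PDer.bracket a b := by
  refine PDer.ext' fun x hx => ?_
  have h : (⟨(t • b).1 ⟨x, lie_self_le I hx⟩, PDer.apply_mem (t • b) hx _⟩ : I) =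
    t • ⟨b.1 ⟨x, lie_self_le I hx⟩, PDer.apply_mem b hx _⟩ := rfl
  change a.1 ⟨(t • b).1 ⟨x, lie_self_le I hx⟩, _⟩ - (t • b).1 _ = t • (a.1 _ - b.1 _)
  rw [h, map_smul, smul_sub]
  rfl

theorem Qm.jacobi [Semiprime Φ L] (p q r : Qm Φ L) : ⁅p, ⁅q, r⁆⁆ = ⁅⁅p, q⁆, r⁆ + ⁅q, ⁅p, r⁆⁆ := by
  refine Qm.ind₃ (P := fun p q r => ⁅p, ⁅q, r⁆⁆ = ⁅⁅p, q⁆, r⁆ + ⁅q, ⁅p, r⁆⁆)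
    (fun I hI a b c => ?_) p q r
  have hS := hI.lie_self
  have hres : ∀ d : PDer I, Qm.mk hI d = Qm.mk hS (PDer.restrict (lie_self_le I) d) :=
    fun d => (Qm.mk_restrict _ _ _ _).symm
  rw [Qm.mk_lie hI b c, Qm.mk_lie hI a b, Qm.mk_lie hI a c, hres a, hres b, hres c, Qm.mk_lie,
    Qm.mk_lie, Qm.mk_lie, ← Qm.mk_add]
  congr 1
  refine PDer.ext' fun x hx => ?_
  have e : ∀ (f : PDer I) (u v w : I), w = u - v → f.1 w = f.1 u - f.1 v := by
    rintro f u v _ rfl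
    exact map_sub _ _ _
  have hx1 : x ∈ ⁅I, I⁆ := lie_self_le _ hx
  have hx0 : x ∈ I := lie_self_le _ hx1
  have m : ∀ f : PDer I, f.1 ⟨x, hx0⟩ ∈ ⁅I, I⁆ := fun f =>
    PDer.apply_mem (PDer.restrict (lie_self_le I) f) hx hx1
  have m' : ∀ f : PDer I, f.1 ⟨x, hx0⟩ ∈ I := fun f => lie_self_le I (m f)
  have mm : ∀ f g : PDer I, f.1 ⟨g.1 ⟨x, hx0⟩, m' g⟩ ∈ I := fun f g => PDer.apply_mem f (m g) _
  have k : ∀ (f g h : PDer I) (hm), f.1 ⟨(PDer.bracket g h).1 ⟨x, hx1⟩, hm⟩ =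
      f.1 ⟨g.1 ⟨h.1 ⟨x, hx0⟩, m' h⟩, mm g h⟩ - f.1 ⟨h.1 ⟨g.1 ⟨x, hx0⟩, m' g⟩, mm h g⟩ :=
    fun f g h hm => e f _ _ _ rfl
  have hm : ∀ g h : PDer I, (PDer.bracket g h).1 ⟨x, hx1⟩ ∈ I := fun g h =>
    sub_mem (mm g h) (mm h g)
  refine (congrArg₂ (· - ·) (k a b c (hm b c)) (PDer.bracket_apply b c _ (m a))).trans
    (Eq.trans ?_ (congrArg₂ (· + ·)
      (congrArg₂ (· - ·) (PDer.bracket_apply a b _ (m c)) (k c a b (hm a b)))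
      (congrArg₂ (· - ·) (k b a c (hm a c)) (PDer.bracket_apply a c _ (m b)))).symm)
  abel

noncomputable instance [Semiprime Φ L] : LieRing (Qm Φ L) where
  add_lie p q r := by
    refine Qm.ind₃ (P := fun p q r => ⁅p + q, r⁆ = ⁅p, r⁆ + ⁅q, r⁆) (fun I hI a b c => ?_) p q r
    rw [← Qm.mk_add, Qm.mk_lie, Qm.mk_lie, Qm.mk_lie, ← Qm.mk_add, PDer.bracket_add_left]
  lie_add p q r := by
    refine Qm.ind₃ (P := fun p q r => ⁅p, q + r⁆ = ⁅p, q⁆ + ⁅p, r⁆) (fun I hI a b c => ?_) p q r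
    rw [← Qm.mk_add, Qm.mk_lie, Qm.mk_lie, Qm.mk_lie, ← Qm.mk_add, PDer.bracket_skew,
      PDer.bracket_add_left, PDer.bracket_skew a b, PDer.bracket_skew a c, neg_add]
  lie_self p := by
    refine Qm.ind₃ (P := fun p _ _ => ⁅p, p⁆ = 0) (fun I hI a _ _ => ?_) p p p
    rw [Qm.mk_lie, ← Qm.mk_zero hI.lie_self]
    congr 1
    exact PDer.ext' fun x hx => sub_self _
  leibniz_lie := Qm.jacobi

noncomputable instance [Semiprime Φ L] : LieAlgebra Φ (Qm Φ L) where
  lie_smul t p q := by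
    refine Qm.ind₃ (P := fun p q _ => ⁅p, t • q⁆ = t • ⁅p, q⁆) (fun I hI a b _ => ?_) p q q
    rw [← Qm.mk_smul, Qm.mk_lie, Qm.mk_lie, ← Qm.mk_smul, PDer.bracket_smul]

/-- The inner derivation `ad x : L → L`. -/
def PDer.ad (x : L) : PDer (⊤ : LieIdeal Φ L) :=
  ⟨(LieAlgebra.ad Φ L x).comp (⊤ : LieIdeal Φ L).toSubmodule.subtype, fun y z => by
    change ⁅x, ⁅(y : L), (z : L)⁆⁆ = ⁅⁅x, (y : L)⁆, (z : L)⁆ + ⁅(y : L), ⁅x, (z : L)⁆⁆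
    exact leibniz_lie _ _ _⟩

variable (Φ L) in
/-- The canonical map `L → Q_m(L)`, `x ↦ (ad x)_L`. -/
def Qm.of : L →ₗ[Φ] Qm Φ L where
  toFun x := Qm.mk IsEssential.top (PDer.ad x)
  map_add' x y := by
    rw [← Qm.mk_add]
    congr 1
    exact PDer.ext' fun z hz => add_lie x y z
  map_smul' c x := by
    rw [RingHom.id_apply, ← Qm.mk_smul]
    congr 1
    exact PDer.ext' fun z hz => smul_lie c x z

/-- The derivation `e ∘ δ ∘ e⁻¹`, defined on `e(I)`. -/
def PDer.conj (e : L ≃ₗ⁅Φ⁆ L) {I : LieIdeal Φ L} (δ : PDer I) :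
    PDer (I.comap (e.symm : L →ₗ⁅Φ⁆ L)) :=
  ⟨{ toFun := fun x => e (δ.1 ⟨e.symm x, x.2⟩)
     map_add' := fun x y => by
      rw [← map_add, ← map_add]
      congr 2
      exact Subtype.ext (map_add e.symm (x : L) y)
     map_smul' := fun c x => by
      rw [RingHom.id_apply, ← map_smul, ← map_smul]
      congr 2
      exact Subtype.ext (map_smul e.symm c (x : L)) }, fun x y => by
    have h := PDer.apply_lie δ (x := e.symm x) (y := e.symm y) x.2 y.2 (lie_mem_right Φ L I _ _ y.2)
    have h2 := congrArg e h
    rw [map_add, LieEquiv.map_lie, LieEquiv.map_lie, LieEquiv.apply_symm_apply,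
      LieEquiv.apply_symm_apply] at h2
    refine Eq.trans ?_ h2
    change e (δ.1 ⟨e.symm ⁅(x : L), (y : L)⁆, _⟩) = _
    congr 2
    exact Subtype.ext (LieEquiv.map_lie e.symm _ _)⟩

theorem ne_bot_iff_mem (I : LieIdeal Φ L) : I ≠ ⊥ ↔ ∃ x ∈ I, x ≠ 0 := by
  rw [ne_eq, LieSubmodule.eq_bot_iff]
  push Not
  rfl

theorem IsEssential.comap (e : L ≃ₗ⁅Φ⁆ L) {I : LieIdeal Φ L} (hI : IsEssential I) :
    IsEssential (I.comap (e.symm : L →ₗ⁅Φ⁆ L)) := by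
  intro J hJ h
  obtain ⟨z, hz, hz0⟩ := (ne_bot_iff_mem _).mp hJ
  have hJ' : J.comap (e : L →ₗ⁅Φ⁆ L) ≠ ⊥ := (ne_bot_iff_mem _).mpr
    ⟨e.symm z, by
      change e (e.symm z) ∈ J
      rwa [LieEquiv.apply_symm_apply], fun h0 => hz0 (by
      rw [← e.apply_symm_apply z, h0, map_zero])⟩
  obtain ⟨w, hw, hw0⟩ := (ne_bot_iff_mem _).mp (hI _ hJ')
  obtain ⟨hw1, hw2⟩ := (LieSubmodule.mem_inf _ _ _).mp hw
  have : e w ∈ I.comap (e.symm : L →ₗ⁅Φ⁆ L) ⊓ J := by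
    refine (LieSubmodule.mem_inf _ _ _).mpr ⟨?_, hw2⟩
    change e.symm (e w) ∈ I
    rwa [LieEquiv.symm_apply_apply]
  rw [h, LieSubmodule.mem_bot] at this
  exact hw0 (by rw [← e.symm_apply_apply w, this, map_zero])

/-- The map of `Q_m(L)` induced by an automorphism `e` of `L`: it sends `δ_I` to
`(e ∘ δ ∘ e⁻¹)_{e(I)}`. -/
def Qm.conj (e : L ≃ₗ⁅Φ⁆ L) : Qm Φ L → Qm Φ L :=
  DirectLimit.lift (derSystemMap (Φ := Φ) (L := L))
    (fun I δ => Qm.mk ((OrderDual.ofDual I).2.comap e) (PDer.conj e δ))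
    (fun I J h _ => Qm.sound _ _ ((OrderDual.ofDual J).2.comap e)
      (fun x (hx : e.symm x ∈ (OrderDual.ofDual J).1) =>
        show e.symm x ∈ (OrderDual.ofDual I).1 from
        (show (OrderDual.ofDual J).1 ≤ (OrderDual.ofDual I).1 from h) hx) le_rfl _ _
      fun _ _ => rfl)

theorem Qm.conj_mk (e : L ≃ₗ⁅Φ⁆ L) {I : LieIdeal Φ L} (hI : IsEssential I) (δ : PDer I) :
    Qm.conj e (Qm.mk hI δ) = Qm.mk (hI.comap e) (PDer.conj e δ) := rfl

end Basic

section Graded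

variable {Φ L G : Type*} [CommRing Φ] [LieRing L] [LieAlgebra Φ L]
  [AddCommGroup G] [DecidableEq G] (ℒ : G → Submodule Φ L) [GradedLieAlgebra ℒ]

/-- A derivation `δ : I → L` has degree `σ` if `δ(I ∩ L_τ) ⊆ L_{τ + σ}` for all `τ`. -/
def PDer.HasDegree {I : LieIdeal Φ L} (δ : PDer I) (σ : G) : Prop :=
  ∀ (τ : G) (x : I), (x : L) ∈ ℒ τ → δ.1 x ∈ ℒ (τ + σ)

/-- The degree `σ` component of `Q_m(L)`: the classes of the derivations of degree `σ` defined on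
graded essential ideals of `L`. -/
def Qm.component (σ : G) : Submodule Φ (Qm Φ L) where
  carrier := {q | ∃ (I : LieIdeal Φ L) (hI : IsEssential I) (δ : PDer I),
    DirectSum.SetLike.IsHomogeneous ℒ I ∧ PDer.HasDegree ℒ δ σ ∧ q = Qm.mk hI δ}
  zero_mem' := ⟨⊤, IsEssential.top, 0, fun _ _ _ => LieSubmodule.mem_top _,
    fun _ _ _ => zero_mem _, (Qm.mk_zero _).symm⟩
  add_mem' := by
    rintro _ _ ⟨I, hI, δ, gI, hδ, rfl⟩ ⟨J, hJ, μ, gJ, hμ, rfl⟩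
    refine ⟨I ⊓ J, hI.inf hJ, PDer.restrict inf_le_left δ + PDer.restrict inf_le_right μ, ?_, ?_,
      ?_⟩
    · intro i m hm
      obtain ⟨h1, h2⟩ := (LieSubmodule.mem_inf _ _ _).mp hm
      exact (LieSubmodule.mem_inf _ _ _).mpr ⟨gI i h1, gJ i h2⟩
    · intro τ x hx
      exact add_mem (hδ τ _ hx) (hμ τ _ hx)
    · rw [Qm.mk_add, Qm.mk_restrict hI, Qm.mk_restrict hJ]
  smul_mem' := by
    rintro c _ ⟨I, hI, δ, gI, hδ, rfl⟩
    exact ⟨I, hI, c • δ, gI, fun τ x hx => Submodule.smul_mem _ _ (hδ τ x hx), rfl⟩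

theorem Qm.of_mem_component {σ : G} {x : L} (hx : x ∈ ℒ σ) :
    Qm.of Φ L x ∈ Qm.component ℒ σ := by
  refine ⟨⊤, IsEssential.top, PDer.ad x, fun _ _ _ => LieSubmodule.mem_top _, ?_, rfl⟩
  intro τ y hy
  rw [add_comm]
  exact SetLike.GradedBracket.bracket_mem hx hy

end Graded

end LieQuot

/-! ### Jordan pairs and their Tits-Kantor-Koecher algebras -/

/-- A (linear) Jordan pair `(V⁺, V⁻)` over `Φ`, given by its triple products
`{x, y, z} = tp x y z` and `{x, y, z} = tm x y z`; over a ring of scalars containing `1/6` these are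
the Jordan pairs, with quadratic maps `Q_x y = ½ {x, y, x}`. -/
class JordanPair (Φ Vp Vm : Type*) [CommRing Φ] [AddCommGroup Vp] [Module Φ Vp]
    [AddCommGroup Vm] [Module Φ Vm] where
  tp : Vp →ₗ[Φ] Vm →ₗ[Φ] Vp →ₗ[Φ] Vp
  tm : Vm →ₗ[Φ] Vp →ₗ[Φ] Vm →ₗ[Φ] Vm
  tp_comm : ∀ x y z, tp x y z = tp z y x
  tm_comm : ∀ x y z, tm x y z = tm z y x
  tp_jordan : ∀ x y u v z,
    tp x y (tp u v z) = tp (tp x y u) v z - tp u (tm y x v) z + tp u v (tp x y z)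
  tm_jordan : ∀ x y u v z,
    tm x y (tm u v z) = tm (tm x y u) v z - tm u (tp y x v) z + tm u v (tm x y z)

/-- A (linear) Jordan triple system over `Φ` with triple product `{x, y, z} = triple x y z`; over a
ring of scalars containing `1/6` these are the Jordan triple systems, with quadratic map
`P_x y = ½ {x, y, x}`. -/
class JordanTripleSystem (Φ T : Type*) [CommRing Φ] [AddCommGroup T] [Module Φ T] where
  triple : T →ₗ[Φ] T →ₗ[Φ] T →ₗ[Φ] T
  triple_comm : ∀ x y z, triple x y z = triple z y x
  triple_jordan : ∀ x y u v z, triple x y (triple u v z) =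
    triple (triple x y u) v z - triple u (triple y x v) z + triple u v (triple x y z)

/-- The double Jordan pair `V(T) = (T, T)` of a Jordan triple system. -/
instance JordanTripleSystem.doublePair (Φ T : Type*) [CommRing Φ] [AddCommGroup T] [Module Φ T]
    [JordanTripleSystem Φ T] : JordanPair Φ T T where
  tp := triple
  tm := triple
  tp_comm := triple_comm
  tm_comm := triple_comm
  tp_jordan := triple_jordan
  tm_jordan := triple_jordan

namespace JordanPair

attribute [local instance] LieRing.ofAssociativeRing

variable (Φ Vp Vm : Type*) [CommRing Φ] [AddCommGroup Vp] [Module Φ Vp]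
  [AddCommGroup Vm] [Module Φ Vm] [JordanPair Φ Vp Vm]

/-- A Jordan pair is strongly nondegenerate if it has no nonzero absolute zero divisors
(elements `x` with `Q_x = 0`). -/
class StronglyNondegenerate : Prop where
  eq_zero_of_tp : ∀ x : Vp, (∀ y : Vm, tp (Φ := Φ) x y x = 0) → x = 0
  eq_zero_of_tm : ∀ x : Vm, (∀ y : Vp, tm (Φ := Φ) x y x = 0) → x = 0

variable {Vp Vm} in
/-- The inner derivation `δ(x, y) = (D_{x,y}, -D_{y,x})`. -/
def innerDer (x : Vp) (y : Vm) : Module.End Φ Vp × Module.End Φ Vm :=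
  (tp x y, -tm y x)

/-- `γ = (γ⁺, γ⁻)` is a derivation of the Jordan pair. -/
def IsDerivation (γ : Module.End Φ Vp × Module.End Φ Vm) : Prop :=
  (∀ x y z, γ.1 (tp (Φ := Φ) x y z) = tp (Φ := Φ) (γ.1 x) y z + tp (Φ := Φ) x (γ.2 y) z +
    tp (Φ := Φ) x y (γ.1 z)) ∧
  (∀ x y z, γ.2 (tm (Φ := Φ) x y z) = tm (Φ := Φ) (γ.2 x) y z + tm (Φ := Φ) x (γ.1 y) z +
    tm (Φ := Φ) x y (γ.2 z))

variable {Vp Vm} in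
theorem isDerivation_innerDer (x : Vp) (y : Vm) : IsDerivation Φ Vp Vm (innerDer Φ x y) := by
  constructor
  · intro u v z
    simp only [innerDer, LinearMap.neg_apply, map_neg]
    rw [tp_jordan]
    abel
  · intro u v z
    simp only [innerDer, LinearMap.neg_apply, map_neg]
    rw [tm_jordan]
    abel

theorem innerDer_add_left (x x' : Vp) (y : Vm) :
    innerDer Φ (x + x') y = innerDer Φ x y + innerDer Φ x' y := by
  refine Prod.ext ?_ ?_
  · simp [innerDer]
  · simp [innerDer, add_comm]

theorem innerDer_add_right (x : Vp) (y y' : Vm) :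
    innerDer Φ x (y + y') = innerDer Φ x y + innerDer Φ x y' := by
  refine Prod.ext ?_ ?_
  · simp [innerDer]
  · simp [innerDer, add_comm]

theorem innerDer_smul_left (c : Φ) (x : Vp) (y : Vm) :
    innerDer Φ (c • x) y = c • innerDer Φ x y := by
  refine Prod.ext ?_ ?_
  · simp [innerDer]
  · simp [innerDer]

theorem innerDer_smul_right (c : Φ) (x : Vp) (y : Vm) :
    innerDer Φ x (c • y) = c • innerDer Φ x y := by
  refine Prod.ext ?_ ?_
  · simp [innerDer]
  · simp [innerDer]

variable {Vp Vm} in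
theorem lie_innerDer {γ : Module.End Φ Vp × Module.End Φ Vm} (hγ : IsDerivation Φ Vp Vm γ)
    (x : Vp) (y : Vm) :
    ⁅γ, innerDer Φ x y⁆ = innerDer Φ (γ.1 x) y + innerDer Φ x (γ.2 y) := by
  rw [Ring.lie_def]
  refine Prod.ext (LinearMap.ext fun z => ?_) (LinearMap.ext fun z => ?_)
  · change γ.1 (tp (Φ := Φ) x y z) - tp (Φ := Φ) x y (γ.1 z) =
      tp (Φ := Φ) (γ.1 x) y z + tp (Φ := Φ) x (γ.2 y) z
    rw [hγ.1]
    abel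
  · change γ.2 (-tm (Φ := Φ) y x z) - -tm (Φ := Φ) y x (γ.2 z) =
      -tm (Φ := Φ) y (γ.1 x) z + -tm (Φ := Φ) (γ.2 y) x z
    rw [map_neg, hγ.2]
    abel

/-- The `Φ`-span of the inner derivations. -/
def innerSpan : Submodule Φ (Module.End Φ Vp × Module.End Φ Vm) :=
  Submodule.span Φ {γ | ∃ (x : Vp) (y : Vm), innerDer Φ x y = γ}

theorem isDerivation_of_mem {γ : Module.End Φ Vp × Module.End Φ Vm}
    (h : γ ∈ innerSpan Φ Vp Vm) : IsDerivation Φ Vp Vm γ := by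
  refine Submodule.span_induction ?_ ?_ ?_ ?_ h
  · rintro _ ⟨x, y, rfl⟩
    exact isDerivation_innerDer Φ x y
  · constructor <;> intros <;> simp
  · intro a b _ _ ha hb
    constructor
    · intro x y z
      simp only [Prod.fst_add, Prod.snd_add, LinearMap.add_apply, map_add, ha.1, hb.1]
      abel
    · intro x y z
      simp only [Prod.fst_add, Prod.snd_add, LinearMap.add_apply, map_add, ha.2, hb.2]
      abel
  · intro c a _ ha
    constructor
    · intro x y z
      simp only [Prod.smul_fst, Prod.smul_snd, LinearMap.smul_apply, map_smul, ha.1, smul_add]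
    · intro x y z
      simp only [Prod.smul_fst, Prod.smul_snd, LinearMap.smul_apply, map_smul, ha.2, smul_add]

/-- The Lie algebra `IDer(V)` of inner derivations, i.e. the `Φ`-span of all `δ(x, y)`. -/
def IDer : LieSubalgebra Φ (Module.End Φ Vp × Module.End Φ Vm) where
  toSubmodule := innerSpan Φ Vp Vm
  lie_mem' := by
    intro γ μ hγ hμ
    have hd := isDerivation_of_mem Φ Vp Vm hγ
    change μ ∈ innerSpan Φ Vp Vm at hμ
    change ⁅γ, μ⁆ ∈ innerSpan Φ Vp Vm
    refine Submodule.span_induction (p := fun μ _ => ⁅γ, μ⁆ ∈ innerSpan Φ Vp Vm) ?_ ?_ ?_ ?_ hμ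
    · rintro _ ⟨x, y, rfl⟩
      rw [lie_innerDer Φ hd]
      exact add_mem (Submodule.subset_span ⟨_, _, rfl⟩) (Submodule.subset_span ⟨_, _, rfl⟩)
    · rw [lie_zero]
      exact zero_mem _
    · intro a b _ _ ha hb
      rw [lie_add]
      exact add_mem ha hb
    · intro c a _ ha
      rw [lie_smul]
      exact Submodule.smul_mem _ c ha

variable {Vp Vm} in
/-- `δ(x, y)` as an element of `IDer(V)`. -/
def inner (x : Vp) (y : Vm) : IDer Φ Vp Vm :=
  ⟨innerDer Φ x y, Submodule.subset_span ⟨x, y, rfl⟩⟩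

/-- The Tits-Kantor-Koecher algebra `TKK(V) = V⁺ ⊕ IDer(V) ⊕ V⁻`. -/
def TKK : Type _ := Vp × IDer Φ Vp Vm × Vm

namespace TKK

noncomputable instance : AddCommGroup (TKK Φ Vp Vm) :=
  inferInstanceAs (AddCommGroup (Vp × IDer Φ Vp Vm × Vm))

noncomputable instance : Module Φ (TKK Φ Vp Vm) :=
  inferInstanceAs (Module Φ (Vp × IDer Φ Vp Vm × Vm))

variable {Φ Vp Vm}

/-- The element `x ⊕ γ ⊕ y` of `TKK(V)`. -/
def mk (x : Vp) (γ : IDer Φ Vp Vm) (y : Vm) : TKK Φ Vp Vm := (x, γ, y)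

/-- The component in `V⁺`. -/
def pos (a : TKK Φ Vp Vm) : Vp := a.1

/-- The component in `IDer(V)`. -/
def der (a : TKK Φ Vp Vm) : IDer Φ Vp Vm := a.2.1

/-- The component in `V⁻`. -/
def neg (a : TKK Φ Vp Vm) : Vm := a.2.2

theorem ext {a b : TKK Φ Vp Vm} (h1 : a.pos = b.pos) (h0 : a.der = b.der) (h2 : a.neg = b.neg) :
    a = b := Prod.ext h1 (Prod.ext h0 h2)

@[simp] theorem pos_mk (x : Vp) (γ : IDer Φ Vp Vm) (y : Vm) : (mk x γ y).pos = x := rfl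
@[simp] theorem der_mk (x : Vp) (γ : IDer Φ Vp Vm) (y : Vm) : (mk x γ y).der = γ := rfl
@[simp] theorem neg_mk (x : Vp) (γ : IDer Φ Vp Vm) (y : Vm) : (mk x γ y).neg = y := rfl
@[simp] theorem pos_add (a b : TKK Φ Vp Vm) : (a + b).pos = a.pos + b.pos := rfl
@[simp] theorem der_add (a b : TKK Φ Vp Vm) : (a + b).der = a.der + b.der := rfl
@[simp] theorem neg_add (a b : TKK Φ Vp Vm) : (a + b).neg = a.neg + b.neg := rfl
@[simp] theorem pos_smul (c : Φ) (a : TKK Φ Vp Vm) : (c • a).pos = c • a.pos := rfl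
@[simp] theorem der_smul (c : Φ) (a : TKK Φ Vp Vm) : (c • a).der = c • a.der := rfl
@[simp] theorem neg_smul (c : Φ) (a : TKK Φ Vp Vm) : (c • a).neg = c • a.neg := rfl
@[simp] theorem pos_zero : (0 : TKK Φ Vp Vm).pos = 0 := rfl
@[simp] theorem der_zero : (0 : TKK Φ Vp Vm).der = 0 := rfl
@[simp] theorem neg_zero : (0 : TKK Φ Vp Vm).neg = 0 := rfl

/-- `[x⁺ ⊕ γ ⊕ x⁻, y⁺ ⊕ μ ⊕ y⁻] =
(γ₊ y⁺ - μ₊ x⁺) ⊕ ([γ, μ] + δ(x⁺, y⁻) - δ(y⁺, x⁻)) ⊕ (γ₋ y⁻ - μ₋ x⁻)`. -/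
noncomputable instance : Bracket (TKK Φ Vp Vm) (TKK Φ Vp Vm) where
  bracket a b := mk (a.der.1.1 b.pos - b.der.1.1 a.pos)
    (⁅a.der, b.der⁆ + inner Φ a.pos b.neg - inner Φ b.pos a.neg)
    (a.der.1.2 b.neg - b.der.1.2 a.neg)

theorem pos_lie (a b : TKK Φ Vp Vm) : ⁅a, b⁆.pos = a.der.1.1 b.pos - b.der.1.1 a.pos := rfl

theorem der_lie (a b : TKK Φ Vp Vm) :
    ⁅a, b⁆.der = ⁅a.der, b.der⁆ + inner Φ a.pos b.neg - inner Φ b.pos a.neg := rfl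

theorem neg_lie (a b : TKK Φ Vp Vm) : ⁅a, b⁆.neg = a.der.1.2 b.neg - b.der.1.2 a.neg := rfl

theorem inner_add_left (x x' : Vp) (y : Vm) :
    inner Φ (x + x') y = inner Φ x y + inner Φ x' y :=
  Subtype.ext (innerDer_add_left Φ Vp Vm x x' y)

theorem inner_add_right (x : Vp) (y y' : Vm) :
    inner Φ x (y + y') = inner Φ x y + inner Φ x y' :=
  Subtype.ext (innerDer_add_right Φ Vp Vm x y y')

theorem inner_smul_left (c : Φ) (x : Vp) (y : Vm) : inner Φ (c • x) y = c • inner Φ x y :=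
  Subtype.ext (innerDer_smul_left Φ Vp Vm c x y)

theorem inner_smul_right (c : Φ) (x : Vp) (y : Vm) : inner Φ x (c • y) = c • inner Φ x y :=
  Subtype.ext (innerDer_smul_right Φ Vp Vm c x y)

theorem inner_sub_left (x x' : Vp) (y : Vm) :
    inner Φ (x - x') y = inner Φ x y - inner Φ x' y := by
  rw [eq_sub_iff_add_eq, ← inner_add_left, sub_add_cancel]

theorem inner_sub_right (x : Vp) (y y' : Vm) :
    inner Φ x (y - y') = inner Φ x y - inner Φ x y' := by
  rw [eq_sub_iff_add_eq, ← inner_add_right, sub_add_cancel]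

theorem lie_inner (γ : IDer Φ Vp Vm) (x : Vp) (y : Vm) :
    ⁅γ, inner Φ x y⁆ = inner Φ (γ.1.1 x) y + inner Φ x (γ.1.2 y) :=
  Subtype.ext (lie_innerDer Φ (isDerivation_of_mem Φ Vp Vm γ.2) x y)

theorem inner_fst (x z : Vp) (y : Vm) : (inner Φ x y).1.1 z = tp (Φ := Φ) x y z := rfl

theorem inner_snd (x : Vp) (y z : Vm) : (inner Φ x y).1.2 z = -tm (Φ := Φ) y x z := rfl

theorem add_fst (γ μ : IDer Φ Vp Vm) (z : Vp) : (γ + μ).1.1 z = γ.1.1 z + μ.1.1 z := rfl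
theorem add_snd (γ μ : IDer Φ Vp Vm) (z : Vm) : (γ + μ).1.2 z = γ.1.2 z + μ.1.2 z := rfl
theorem sub_fst (γ μ : IDer Φ Vp Vm) (z : Vp) : (γ - μ).1.1 z = γ.1.1 z - μ.1.1 z := rfl
theorem sub_snd (γ μ : IDer Φ Vp Vm) (z : Vm) : (γ - μ).1.2 z = γ.1.2 z - μ.1.2 z := rfl
theorem lie_fst (γ μ : IDer Φ Vp Vm) (z : Vp) :
    (⁅γ, μ⁆ : IDer Φ Vp Vm).1.1 z = γ.1.1 (μ.1.1 z) - μ.1.1 (γ.1.1 z) := rfl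
theorem lie_snd (γ μ : IDer Φ Vp Vm) (z : Vm) :
    (⁅γ, μ⁆ : IDer Φ Vp Vm).1.2 z = γ.1.2 (μ.1.2 z) - μ.1.2 (γ.1.2 z) := rfl

theorem jacobi (a b c : TKK Φ Vp Vm) : ⁅a, ⁅b, c⁆⁆ = ⁅⁅a, b⁆, c⁆ + ⁅b, ⁅a, c⁆⁆ := by
  refine ext ?_ ?_ ?_
  · simp only [pos_lie, der_lie, pos_add, map_sub, add_fst, sub_fst, lie_fst,
      inner_fst]
    rw [tp_comm b.pos c.neg a.pos, tp_comm c.pos b.neg a.pos, tp_comm c.pos a.neg b.pos]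
    abel
  · simp only [pos_lie, der_lie, neg_lie, der_add, lie_add, lie_sub, add_lie, sub_lie,
      inner_sub_left, inner_sub_right, lie_inner]
    rw [← lie_skew (inner Φ a.pos b.neg), ← lie_skew (inner Φ b.pos a.neg), lie_inner, lie_inner,
      leibniz_lie a.der b.der c.der]
    abel
  · simp only [der_lie, neg_lie, neg_add, map_sub, add_snd, sub_snd, lie_snd,
      inner_snd]
    rw [tm_comm c.neg b.pos a.neg, tm_comm b.neg c.pos a.neg, tm_comm c.neg a.pos b.neg]
    abel

noncomputable instance : LieRing (TKK Φ Vp Vm) where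
  add_lie a b c := by
    refine ext ?_ ?_ ?_
    · simp only [pos_lie, pos_add, der_add, map_add, add_fst]
      abel
    · simp only [der_lie, pos_add, der_add, neg_add, add_lie, inner_add_left, inner_add_right]
      abel
    · simp only [neg_lie, neg_add, der_add, map_add, add_snd]
      abel
  lie_add a b c := by
    refine ext ?_ ?_ ?_
    · simp only [pos_lie, pos_add, der_add, map_add, add_fst]
      abel
    · simp only [der_lie, pos_add, der_add, neg_add, lie_add, inner_add_left, inner_add_right]
      abel
    · simp only [neg_lie, neg_add, der_add, map_add, add_snd]
      abel
  lie_self a := by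
    refine ext ?_ ?_ ?_
    · simp [pos_lie]
    · simp [der_lie]
    · simp [neg_lie]
  leibniz_lie := jacobi

noncomputable instance : LieAlgebra Φ (TKK Φ Vp Vm) where
  lie_smul t a b := by
    refine ext ?_ ?_ ?_
    · rw [pos_smul, pos_lie, pos_lie, smul_sub, pos_smul, map_smul]
      rfl
    · simp only [der_lie, pos_smul, der_smul, neg_smul, lie_smul, inner_smul_left,
        inner_smul_right, smul_add, smul_sub]
    · rw [neg_smul, neg_lie, neg_lie, smul_sub, neg_smul, map_smul]
      rfl

variable (Φ Vp Vm) in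
/-- The 3-grading of `TKK(V)`: `TKK(V)₁ = V⁺`, `TKK(V)₀ = IDer(V)`, `TKK(V)₋₁ = V⁻`, and
`TKK(V)ₙ = 0` for all other `n`. -/
def grading (n : ℤ) : Submodule Φ (TKK Φ Vp Vm) where
  carrier := {a | (n ≠ 1 → a.pos = 0) ∧ (n ≠ 0 → a.der = 0) ∧ (n ≠ -1 → a.neg = 0)}
  zero_mem' := ⟨fun _ => rfl, fun _ => rfl, fun _ => rfl⟩
  add_mem' := by
    rintro a b ⟨h1, h2, h3⟩ ⟨k1, k2, k3⟩
    exact ⟨fun h => by rw [pos_add, h1 h, k1 h, add_zero],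
      fun h => by rw [der_add, h2 h, k2 h, add_zero],
      fun h => by rw [neg_add, h3 h, k3 h, add_zero]⟩
  smul_mem' := by
    rintro c a ⟨h1, h2, h3⟩
    exact ⟨fun h => by rw [pos_smul, h1 h, smul_zero],
      fun h => by rw [der_smul, h2 h, smul_zero],
      fun h => by rw [neg_smul, h3 h, smul_zero]⟩

theorem mem_grading {n : ℤ} {a : TKK Φ Vp Vm} : a ∈ grading Φ Vp Vm n ↔
    (n ≠ 1 → a.pos = 0) ∧ (n ≠ 0 → a.der = 0) ∧ (n ≠ -1 → a.neg = 0) := Iff.rfl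

instance : SetLike.GradedBracket (grading Φ Vp Vm) where
  bracket_mem := by
    intro i j a b ha hb
    rw [mem_grading] at ha hb ⊢
    obtain ⟨a1, a0, a2⟩ := ha
    obtain ⟨b1, b0, b2⟩ := hb
    refine ⟨fun h => ?_, fun h => ?_, fun h => ?_⟩
    · have e1 : a.der.1.1 b.pos = 0 := by
        by_cases hi : i = 0
        · rw [b1 (by omega), map_zero]
        · rw [a0 hi]
          rfl
      have e2 : b.der.1.1 a.pos = 0 := by
        by_cases hj : j = 0
        · rw [a1 (by omega), map_zero]
        · rw [b0 hj]
          rfl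
      rw [pos_lie, e1, e2, sub_zero]
    · have e0 : ⁅a.der, b.der⁆ = 0 := by
        by_cases hi : i = 0
        · rw [b0 (by omega), lie_zero]
        · rw [a0 hi, zero_lie]
      have e1 : inner Φ a.pos b.neg = 0 := by
        by_cases hi : i = 1
        · rw [b2 (by omega), ← sub_self b.neg, inner_sub_right, sub_self]
        · rw [a1 hi, ← sub_self a.pos, inner_sub_left, sub_self]
      have e2 : inner Φ b.pos a.neg = 0 := by
        by_cases hj : j = 1
        · rw [a2 (by omega), ← sub_self a.neg, inner_sub_right, sub_self]
        · rw [b1 hj, ← sub_self b.pos, inner_sub_left, sub_self]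
      rw [der_lie, e0, e1, e2, add_zero, sub_zero]
    · have e1 : a.der.1.2 b.neg = 0 := by
        by_cases hi : i = 0
        · rw [b2 (by omega), map_zero]
        · rw [a0 hi]
          rfl
      have e2 : b.der.1.2 a.neg = 0 := by
        by_cases hj : j = 0
        · rw [a2 (by omega), map_zero]
        · rw [b0 hj]
          rfl
      rw [neg_lie, e1, e2, sub_zero]

/-- The inclusions of the three homogeneous components, as elements of the graded pieces. -/
def homPos (a : TKK Φ Vp Vm) : grading Φ Vp Vm 1 :=
  ⟨mk a.pos 0 0, fun h => absurd rfl h, fun _ => rfl, fun _ => rfl⟩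

/-- See `homPos`. -/
def homDer (a : TKK Φ Vp Vm) : grading Φ Vp Vm 0 :=
  ⟨mk 0 a.der 0, fun _ => rfl, fun h => absurd rfl h, fun _ => rfl⟩

/-- See `homPos`. -/
def homNeg (a : TKK Φ Vp Vm) : grading Φ Vp Vm (-1) :=
  ⟨mk 0 0 a.neg, fun _ => rfl, fun _ => rfl, fun h => absurd rfl h⟩

theorem homPos_add (a b : TKK Φ Vp Vm) : homPos (a + b) = homPos a + homPos b :=
  Subtype.ext (ext rfl (add_zero _).symm (add_zero _).symm)

theorem homDer_add (a b : TKK Φ Vp Vm) : homDer (a + b) = homDer a + homDer b :=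
  Subtype.ext (ext (add_zero _).symm rfl (add_zero _).symm)

theorem homNeg_add (a b : TKK Φ Vp Vm) : homNeg (a + b) = homNeg a + homNeg b :=
  Subtype.ext (ext (add_zero _).symm (add_zero _).symm rfl)

/-- The decomposition of an element of `TKK(V)` into its homogeneous components. -/
noncomputable def decomp (a : TKK Φ Vp Vm) : DirectSum ℤ fun n => grading Φ Vp Vm n :=
  DirectSum.of (fun n => grading Φ Vp Vm n) 1 (homPos a) +
    DirectSum.of (fun n => grading Φ Vp Vm n) 0 (homDer a) +
    DirectSum.of (fun n => grading Φ Vp Vm n) (-1) (homNeg a)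

theorem decomp_add (a b : TKK Φ Vp Vm) : decomp (a + b) = decomp a + decomp b := by
  simp only [decomp, homPos_add, homDer_add, homNeg_add, map_add]
  abel

theorem decomp_of (n : ℤ) (x : grading Φ Vp Vm n) :
    decomp (x : TKK Φ Vp Vm) = DirectSum.of (fun n => grading Φ Vp Vm n) n x := by
  obtain ⟨a, h1, h0, h2⟩ := x
  have z1 : a.pos = 0 → homPos a = 0 := fun h => Subtype.ext (ext h rfl rfl)
  have z0 : a.der = 0 → homDer a = 0 := fun h => Subtype.ext (ext rfl h rfl)
  have z2 : a.neg = 0 → homNeg a = 0 := fun h => Subtype.ext (ext rfl rfl h)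
  unfold decomp
  by_cases n1 : n = 1
  · subst n1
    rw [z0 (h0 (by norm_num)), z2 (h2 (by norm_num)), map_zero, map_zero, add_zero, add_zero]
    congr 1
    exact Subtype.ext (ext rfl (h0 (by norm_num)).symm (h2 (by norm_num)).symm)
  by_cases n0 : n = 0
  · subst n0
    rw [z1 (h1 (by norm_num)), z2 (h2 (by norm_num)), map_zero, map_zero, add_zero, zero_add]
    congr 1
    exact Subtype.ext (ext (h1 (by norm_num)).symm rfl (h2 (by norm_num)).symm)
  by_cases n2 : n = -1
  · subst n2
    rw [z1 (h1 (by norm_num)), z0 (h0 (by norm_num)), map_zero, map_zero, add_zero, zero_add]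
    congr 1
    exact Subtype.ext (ext (h1 (by norm_num)).symm (h0 (by norm_num)).symm rfl)
  · rw [z1 (h1 n1), z0 (h0 n0), z2 (h2 n2), map_zero, map_zero, map_zero, add_zero, add_zero]
    have : (⟨a, h1, h0, h2⟩ : grading Φ Vp Vm n) = 0 :=
      Subtype.ext (ext (h1 n1) (h0 n0) (h2 n2))
    rw [this, map_zero]

noncomputable instance : GradedLieAlgebra (grading Φ Vp Vm) where
  decompose' := decomp
  left_inv a := by
    simp only [decomp, map_add, DirectSum.coeAddMonoidHom_of]
    refine ext ?_ ?_ ?_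
    · change a.pos + 0 + 0 = a.pos
      rw [add_zero, add_zero]
    · change 0 + a.der + 0 = a.der
      rw [add_zero, zero_add]
    · change 0 + 0 + a.neg = a.neg
      rw [add_zero, zero_add]
  right_inv x := by
    induction x using DirectSum.induction_on with
    | zero =>
      rw [map_zero]
      have h := decomp_add (0 : TKK Φ Vp Vm) 0
      rw [add_zero] at h
      exact left_eq_add.mp h
    | of i x =>
      rw [DirectSum.coeAddMonoidHom_of]
      exact decomp_of i x
    | add x y hx hy => rw [map_add, decomp_add, hx, hy]

/-- The TKK-algebra of a strongly nondegenerate Jordan pair is semiprime. -/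
instance [StronglyNondegenerate Φ Vp Vm] : LieQuot.Semiprime Φ (TKK Φ Vp Vm) where
  lie_self_ne_bot := by
    intro I hI hII
    apply hI
    have key : ∀ a ∈ I, ∀ b : TKK Φ Vp Vm, ⁅a, ⁅a, b⁆⁆ = 0 := by
      intro a ha b
      have : ⁅a, ⁅a, b⁆⁆ ∈ ⁅I, I⁆ :=
        LieSubmodule.lie_mem_lie ha (lie_mem_left Φ _ I a b ha)
      rwa [hII, LieSubmodule.mem_bot] at this
    have hpos : ∀ a ∈ I, a.pos = 0 := by
      intro a ha
      refine StronglyNondegenerate.eq_zero_of_tp (Φ := Φ) (Vm := Vm) _ fun y => ?_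
      have h := congrArg pos (key a ha (mk 0 0 y))
      simp only [pos_lie, der_lie, pos_mk, der_mk, neg_mk, map_zero, lie_zero, zero_sub,
        zero_add, sub_fst, inner_fst, pos_zero] at h
      have e : (0 : IDer Φ Vp Vm).1.1 a.pos = 0 := rfl
      simpa [e] using h
    have hneg : ∀ a ∈ I, a.neg = 0 := by
      intro a ha
      refine StronglyNondegenerate.eq_zero_of_tm (Φ := Φ) (Vp := Vp) _ fun y => ?_
      have h := congrArg neg (key a ha (mk y 0 0))
      simp only [neg_lie, der_lie, pos_mk, der_mk, neg_mk, map_zero, lie_zero, zero_sub,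
        zero_add, sub_snd, inner_snd, neg_zero] at h
      have e : (0 : IDer Φ Vp Vm).1.2 a.neg = 0 := rfl
      simpa [e, inner_snd] using h
    rw [LieSubmodule.eq_bot_iff]
    intro a ha
    refine ext (hpos a ha) (Subtype.ext (Prod.ext (LinearMap.ext fun x => ?_)
      (LinearMap.ext fun y => ?_))) (hneg a ha)
    · have h := hpos _ (lie_mem_left Φ _ I a (mk x 0 0) ha)
      rw [pos_lie, hpos a ha, map_zero, sub_zero] at h
      exact h
    · have h := hneg _ (lie_mem_left Φ _ I a (mk 0 0 y) ha)
      rw [neg_lie, hneg a ha, map_zero, sub_zero] at h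
      exact h

end TKK

end JordanPair

/-! ### Jordan triple systems -/

namespace JordanTripleSystem

open JordanPair LieQuot

section

variable (Φ T : Type*) [CommRing Φ] [AddCommGroup T] [Module Φ T] [JordanTripleSystem Φ T]

/-- A Jordan triple system is strongly nondegenerate if it has no nonzero absolute zero divisors
(elements `x` with `P_x = 0`). -/
class StronglyNondegenerate : Prop where
  eq_zero : ∀ x : T, (∀ y : T, triple (Φ := Φ) x y x = 0) → x = 0

instance [StronglyNondegenerate Φ T] : JordanPair.StronglyNondegenerate Φ T T where
  eq_zero_of_tp := StronglyNondegenerate.eq_zero (Φ := Φ)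
  eq_zero_of_tm := StronglyNondegenerate.eq_zero (Φ := Φ)

variable {Φ T}

/-- `I` is an ideal of `T`: `{I, T, T} + {T, I, T} + {T, T, I} ⊆ I`. -/
def IsIdeal (I : Submodule Φ T) : Prop :=
  ∀ a ∈ I, ∀ x y : T, triple (Φ := Φ) a x y ∈ I ∧ triple (Φ := Φ) x a y ∈ I ∧
    triple (Φ := Φ) x y a ∈ I

/-- The annihilator of `I` in `T` is zero, where `z` annihilates `I` if
`{z, I, T} = {z, T, I} = {T, z, I} = 0`. -/
def AnnEqZero (I : Submodule Φ T) : Prop :=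
  ∀ z : T, (∀ a ∈ I, ∀ x : T, triple (Φ := Φ) z a x = 0 ∧ triple (Φ := Φ) z x a = 0 ∧
    triple (Φ := Φ) x z a = 0) → z = 0

/-- A linear map that is a homomorphism of Jordan triple systems. -/
def IsTripleHom {W : Type*} [AddCommGroup W] [Module Φ W] [JordanTripleSystem Φ W]
    (f : T →ₗ[Φ] W) : Prop :=
  ∀ x y z, f (triple (Φ := Φ) x y z) = triple (Φ := Φ) (f x) (f y) (f z)

/-- `W` is a Jordan triple system of `𝔐`-quotients of `T`, where `T` is viewed as a subsystem of `W`
through the injective homomorphism `j`: every nonzero `q ∈ W` is absorbed nontrivially into `T` by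
an ideal `I` of `T` with zero annihilator. -/
def IsMQuotients {W : Type*} [AddCommGroup W] [Module Φ W] [JordanTripleSystem Φ W]
    (j : T →ₗ[Φ] W) : Prop :=
  Function.Injective j ∧ IsTripleHom j ∧
  ∀ q : W, q ≠ 0 → ∃ I : Submodule Φ T, IsIdeal I ∧ AnnEqZero I ∧
    (∀ a ∈ I, ∀ x : T,
      triple (Φ := Φ) q (j a) (j x) ∈ LinearMap.range j ∧
      triple (Φ := Φ) q (j x) (j a) ∈ LinearMap.range j ∧
      triple (Φ := Φ) (j a) q (j x) ∈ LinearMap.range j) ∧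
    ∃ a ∈ I, ∃ x : T,
      triple (Φ := Φ) q (j a) (j x) ≠ 0 ∨
      triple (Φ := Φ) q (j x) (j a) ≠ 0 ∨
      triple (Φ := Φ) (j a) q (j x) ≠ 0

/-- `Q`, with `T` embedded through `ι`, is the maximal Jordan triple system of `𝔐`-quotients of `T`:
it is a Jordan triple system of `𝔐`-quotients of `T`, and every Jordan triple system `W` of
`𝔐`-quotients of `T` embeds into `Q` over `T`, in a unique way. -/
def IsMaximalMQuotients {Φ : Type u} {T : Type v} {Q : Type w} [CommRing Φ]
    [AddCommGroup T] [Module Φ T] [JordanTripleSystem Φ T] [AddCommGroup Q] [Module Φ Q]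
    [JordanTripleSystem Φ Q] (ι : T →ₗ[Φ] Q) : Prop :=
  IsMQuotients ι ∧
  ∀ (W : Type x) [AddCommGroup W] [Module Φ W] [JordanTripleSystem Φ W] (j : T →ₗ[Φ] W),
    IsMQuotients j →
    ∃ f : W →ₗ[Φ] Q, IsTripleHom f ∧ Function.Injective f ∧ f ∘ₗ j = ι ∧
      ∀ g : W →ₗ[Φ] Q, IsTripleHom g → g ∘ₗ j = ι → g = f

end

section

variable (Φ T : Type*) [CommRing Φ] [AddCommGroup T] [Module Φ T] [JordanTripleSystem Φ T]

theorem swap_mem {γ : Module.End Φ T × Module.End Φ T} (h : γ ∈ innerSpan Φ T T) :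
    γ.swap ∈ innerSpan Φ T T := by
  refine Submodule.span_induction ?_ ?_ ?_ ?_ h
  · rintro _ ⟨x, y, rfl⟩
    have : (innerDer Φ x y).swap = -innerDer Φ y x := by
      refine Prod.ext rfl ?_
      change triple (Φ := Φ) x y = - -triple (Φ := Φ) x y
      rw [neg_neg]
    rw [this]
    exact neg_mem (Submodule.subset_span ⟨y, x, rfl⟩)
  · exact zero_mem _
  · intro a b _ _ ha hb
    exact add_mem ha hb
  · intro c a _ ha
    exact Submodule.smul_mem _ c ha

variable {Φ T} in
/-- The exchange `(γ⁺, γ⁻) ↦ (γ⁻, γ⁺)` on `IDer(V(T))`. -/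
def swapDer (γ : IDer Φ T T) : IDer Φ T T := ⟨γ.1.swap, swap_mem Φ T γ.2⟩

theorem swapDer_inner (x y : T) :
    swapDer (JordanPair.inner Φ x y) = -JordanPair.inner Φ y x := by
  refine Subtype.ext (Prod.ext rfl ?_)
  change triple (Φ := Φ) x y = - -triple (Φ := Φ) x y
  rw [neg_neg]

/-- The exchange automorphism `x ⊕ (γ⁺, γ⁻) ⊕ y ↦ y ⊕ (γ⁻, γ⁺) ⊕ x` of `TKK(V(T))`. -/
noncomputable def exchange : TKK Φ T T ≃ₗ⁅Φ⁆ TKK Φ T T where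
  toFun a := TKK.mk a.neg (swapDer a.der) a.pos
  invFun a := TKK.mk a.neg (swapDer a.der) a.pos
  left_inv _ := rfl
  right_inv _ := rfl
  map_add' _ _ := rfl
  map_smul' _ _ := rfl
  map_lie' := by
    intro a b
    refine TKK.ext rfl ?_ rfl
    change swapDer (⁅a.der, b.der⁆ + JordanPair.inner Φ a.pos b.neg -
        JordanPair.inner Φ b.pos a.neg) =
      ⁅swapDer a.der, swapDer b.der⁆ + JordanPair.inner Φ a.neg b.pos -
        JordanPair.inner Φ b.neg a.pos
    have h : swapDer (⁅a.der, b.der⁆ + JordanPair.inner Φ a.pos b.neg -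
        JordanPair.inner Φ b.pos a.neg) = ⁅swapDer a.der, swapDer b.der⁆ +
        swapDer (JordanPair.inner Φ a.pos b.neg) - swapDer (JordanPair.inner Φ b.pos a.neg) := rfl
    rw [h, swapDer_inner, swapDer_inner]
    abel

/-- The degree `1` component `(Q_m(TKK(V(T))))₁`. -/
noncomputable abbrev QmOne : Submodule Φ (Qm Φ (TKK Φ T T)) :=
  Qm.component (TKK.grading Φ T T) 1

/-- The inclusion of `T = TKK(V(T))₁` in `TKK(V(T))`. -/
noncomputable def toTKK : T →ₗ[Φ] TKK Φ T T where
  toFun x := TKK.mk x 0 0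
  map_add' _ _ := TKK.ext rfl (add_zero _).symm (add_zero _).symm
  map_smul' c _ := TKK.ext rfl (smul_zero c).symm (smul_zero c).symm

/-- The canonical map `T = TKK(V(T))₁ → (Q_m(TKK(V(T))))₁`. -/
noncomputable def toQmOne : T →ₗ[Φ] QmOne Φ T :=
  ((Qm.of Φ (TKK Φ T T)).comp (toTKK Φ T)).codRestrict _ fun _ =>
    Qm.of_mem_component _ ⟨fun h => absurd rfl h, fun _ => rfl, fun _ => rfl⟩

end

end JordanTripleSystem

/-!
An element `q` of degree `2` of `Q_m(TKK(V(T)))` is zero. For `x`, `y`, `z` of degree `-1` in an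
ideal on which `q` is defined, `S(x, y, z) = [[[q, x], y], z]` is symmetric, and the Jacobi identity
gives `[[q, u], u] = 0` for `u = S(y, y, y)`. Since `[[[q, u], w], [q, u]] = [q, S(u, w, u)]` and
`S(u, w, u) = S(u, u, w)` has the factor `[[q, u], u]`, nondegeneracy yields `[q, u] = 0`.
Polarization (here `1/6` enters) turns this into `[q, S(x, y, z)] = 0`, which by nondegeneracy again
means `[q, y] = 0`. Hence the component of degree `1` is abelian, and an abelian subspace of a Lie
algebra with an involution `τ` is a Jordan triple system under `[[p, τ q], r]`.

If `W` is a Jordan triple system of `𝔐`-quotients of `T`, then an element of `W` annihilated by an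
ideal of `T` with zero annihilator vanishes. So inner derivations of `V(T)` extend uniquely to `W`,
and `TKK(V(T))` embeds in `TKK(V(W))`. An ideal `I` of `T` that absorbs `w ∈ W` generates an ideal
of `TKK(V(T))` whose square is essential and is mapped into `TKK(V(T))` by `ad w`, so that `w`
defines an element of degree `1` of `Q_m(TKK(V(T)))`.
-/

namespace LieQuot

/-! ### Elements of `Q_m(L)` as multiplications into `L` -/

section Basic

variable {Φ L : Type*} [CommRing Φ] [LieRing L] [LieAlgebra Φ L]

theorem toSubmodule_lie_le_iff {I J : LieIdeal Φ L} {N : Submodule Φ L} :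
    (⁅I, J⁆ : LieIdeal Φ L).toSubmodule ≤ N ↔ ∀ a ∈ I, ∀ b ∈ J, ⁅a, b⁆ ∈ N := by
  rw [LieSubmodule.lieIdeal_oper_eq_linear_span', Submodule.span_le]
  exact ⟨fun h a ha b hb => h ⟨a, ha, b, hb, rfl⟩, fun h _ ⟨a, ha, b, hb, hab⟩ => hab ▸ h a ha b hb⟩

theorem IsEssential.eq_zero_of_lie [Semiprime Φ L] {I : LieIdeal Φ L} (hI : IsEssential I) {c : L}
    (hc : ∀ k ∈ I, ⁅c, k⁆ = 0) : c = 0 := by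
  by_contra h0
  have hker : LieModule.ker Φ L I ≠ ⊥ := (ne_bot_iff_mem _).mpr
    ⟨c, (LieModule.mem_ker Φ L I c).mpr fun k => Subtype.ext (hc k k.2), h0⟩
  refine Semiprime.lie_self_ne_bot (Φ := Φ) (L := L) _ (hI _ hker) (le_bot_iff.mp ?_)
  refine toSubmodule_lie_le_iff.mpr fun a ha b hb => ?_
  have hab := (LieModule.mem_ker Φ L I a).mp ((LieSubmodule.mem_inf _ _ _).mp ha).2
    ⟨b, ((LieSubmodule.mem_inf _ _ _).mp hb).1⟩
  exact congrArg Subtype.val hab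

theorem isEssential_of_eq_zero_of_lie {I : LieIdeal Φ L}
    (h : ∀ c : L, (∀ k ∈ I, ⁅c, k⁆ = 0) → c = 0) : IsEssential I := by
  intro J hJ hIJ
  obtain ⟨z, hz, hz0⟩ := (ne_bot_iff_mem _).mp hJ
  refine hz0 (h z fun k hk => ?_)
  have hzk : ⁅z, k⁆ ∈ I ⊓ J :=
    (LieSubmodule.mem_inf _ _ _).mpr ⟨lie_mem_right Φ L I z k hk, lie_mem_left Φ L J z k hz⟩
  rwa [hIJ, LieSubmodule.mem_bot] at hzk

namespace Qm

theorem ind {P : Qm Φ L → Prop}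
    (h : ∀ (I : LieIdeal Φ L) (hI : IsEssential I) (a : PDer I), P (mk hI a)) (p : Qm Φ L) :
    P p :=
  ind₃ (P := fun p _ _ => P p) (fun I hI a _ _ => h I hI a) p p p

theorem ind₂ {P : Qm Φ L → Qm Φ L → Prop}
    (h : ∀ (I : LieIdeal Φ L) (hI : IsEssential I) (a b : PDer I), P (mk hI a) (mk hI b))
    (p q : Qm Φ L) : P p q :=
  ind₃ (P := fun p q _ => P p q) (fun I hI a b _ => h I hI a b) p q q

theorem mk_lie_of [Semiprime Φ L] {I : LieIdeal Φ L} (hI : IsEssential I) (δ : PDer I)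
    {a : L} (ha : a ∈ I) : ⁅mk hI δ, of Φ L a⁆ = of Φ L (δ.1 ⟨a, ha⟩) := by
  change ⁅mk hI δ, mk IsEssential.top (PDer.ad a)⁆ = mk IsEssential.top _
  rw [← mk_restrict IsEssential.top hI le_top (PDer.ad a), mk_lie]
  refine sound _ _ hI.lie_self le_rfl le_top _ _ fun x hx => ?_
  exact sub_eq_of_eq_add (PDer.apply_lie δ ha (lie_self_le I hx) _)

theorem of_lie [Semiprime Φ L] (a b : L) : of Φ L ⁅a, b⁆ = ⁅of Φ L a, of Φ L b⁆ :=
  (mk_lie_of IsEssential.top (PDer.ad a) (LieSubmodule.mem_top b)).symm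

theorem of_injective [Semiprime Φ L] : Function.Injective (of Φ L) := by
  refine (injective_iff_map_eq_zero _).mpr fun a ha => ?_
  obtain ⟨K, _, _, h⟩ := Quotient.exact (ha.trans (mk_zero (Φ := Φ) (L := L) IsEssential.top).symm)
  exact (OrderDual.ofDual K).2.eq_zero_of_lie fun k hk =>
    congrArg (fun d : PDer (OrderDual.ofDual K).1 => d.1 ⟨k, hk⟩) h

theorem ext_of_lie_of [Semiprime Φ L] {I : LieIdeal Φ L} (hI : IsEssential I) {p q : Qm Φ L}
    (h : ∀ k ∈ I, ⁅p, of Φ L k⁆ = ⁅q, of Φ L k⁆) : p = q := by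
  refine ind₂ (P := fun p q => (∀ k ∈ I, ⁅p, of Φ L k⁆ = ⁅q, of Φ L k⁆) → p = q)
    (fun J hJ δ μ h => ?_) p q h
  refine sound hJ hJ (hI.inf hJ) inf_le_right inf_le_right δ μ fun x hx =>
    of_injective (Φ := Φ) ?_
  obtain ⟨hxI, hxJ⟩ := (LieSubmodule.mem_inf _ _ _).mp hx
  rw [← mk_lie_of hJ δ hxJ, ← mk_lie_of hJ μ hxJ, h x hxI]

theorem conj_mk_lie_of [Semiprime Φ L] (e : L ≃ₗ⁅Φ⁆ L) {I : LieIdeal Φ L} (hI : IsEssential I)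
    (δ : PDer I) {k : L} (hk : k ∈ I) :
    ⁅conj e (mk hI δ), of Φ L (e k)⁆ = of Φ L (e (δ.1 ⟨k, hk⟩)) := by
  have hek : e.symm (e k) = k := e.symm_apply_apply k
  have hk' : e k ∈ I.comap (e.symm : L →ₗ⁅Φ⁆ L) := by
    change e.symm (e k) ∈ I
    rwa [hek]
  rw [conj_mk, mk_lie_of _ _ hk']
  change of Φ L (e (δ.1 ⟨e.symm (e k), hk'⟩)) = _
  congr 4

/-- The map of `Q_m(L)` induced by an automorphism of `L`, as a homomorphism of Lie algebras. -/
def conjHom [Semiprime Φ L] (e : L ≃ₗ⁅Φ⁆ L) : Qm Φ L →ₗ⁅Φ⁆ Qm Φ L where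
  toFun := conj e
  map_add' := ind₂ fun I hI a b => by
    rw [← mk_add, conj_mk, conj_mk, conj_mk, ← mk_add]
    congr 1
    exact PDer.ext' fun x hx => map_add e _ _
  map_smul' c := ind fun I hI a => by
    rw [RingHom.id_apply, ← mk_smul, conj_mk, conj_mk, ← mk_smul]
    congr 1
    exact PDer.ext' fun x hx => map_smul e _ _
  map_lie' {p q} := by
    refine ind₂ (P := fun p q => conj e ⁅p, q⁆ = ⁅conj e p, conj e q⁆)
      (fun I hI a b => ext_of_lie_of (hI.lie_self.comap e) fun k hk => ?_) p q
    obtain ⟨k, rfl⟩ : ∃ l, e l = k := ⟨_, e.apply_symm_apply k⟩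
    have hk' : k ∈ ⁅I, I⁆ := e.symm_apply_apply k ▸ hk
    have hkI := lie_self_le I hk'
    rw [mk_lie, conj_mk_lie_of e _ _ hk', PDer.bracket_apply, lie_lie,
      conj_mk_lie_of e hI b hkI, conj_mk_lie_of e hI a hkI,
      conj_mk_lie_of e hI a (PDer.apply_mem b hk' hkI),
      conj_mk_lie_of e hI b (PDer.apply_mem a hk' hkI), map_sub, map_sub]

theorem conj_lie [Semiprime Φ L] (e : L ≃ₗ⁅Φ⁆ L) (p q : Qm Φ L) :
    conj e ⁅p, q⁆ = ⁅conj e p, conj e q⁆ :=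
  (conjHom e).map_lie' (x := p) (y := q)

theorem conj_of (e : L ≃ₗ⁅Φ⁆ L) (a : L) : conj e (of Φ L a) = of Φ L (e a) := by
  change conj e (mk _ _) = mk _ _
  rw [conj_mk]
  refine sound _ _ (IsEssential.top.comap e) le_rfl le_top _ _ fun x hx => ?_
  change e ⁅a, e.symm x⁆ = ⁅e a, x⁆
  rw [LieEquiv.map_lie, LieEquiv.apply_symm_apply]

theorem conj_conj {e : L ≃ₗ⁅Φ⁆ L} (he : ∀ a, e (e a) = a) (p : Qm Φ L) :
    conj e (conj e p) = p := by
  have he' (x : L) : e.symm (e.symm x) = x := by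
    conv_lhs => rw [← he x, LieEquiv.symm_apply_apply, LieEquiv.symm_apply_apply]
  refine ind (P := fun p => conj e (conj e p) = p) (fun I hI a => ?_) p
  rw [conj_mk, conj_mk]
  refine sound _ _ hI (fun x hx => ?_) le_rfl _ _ fun x hx => ?_
  · change e.symm (e.symm x) ∈ I
    rwa [he']
  · change e (e (a.1 ⟨e.symm (e.symm x), _⟩)) = a.1 ⟨x, hx⟩
    rw [he]
    congr 2
    exact he' x

end Qm

end Basic

section Extension

variable {Φ L M : Type*} [CommRing Φ] [LieRing L] [LieAlgebra Φ L] [LieRing M] [LieAlgebra Φ M]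

/-- The elements of `L` which `m ∈ M` multiplies into `L`, where `L` is mapped to `M` by `φ`. -/
def absorber (φ : L →ₗ⁅Φ⁆ M) (m : M) : LieSubalgebra Φ L where
  toSubmodule := (φ.range.toSubmodule.comap (LieModule.toEnd Φ M M m)).comap φ.toLinearMap
  lie_mem' {k l} hk hl := by
    change ⁅m, φ ⁅k, l⁆⁆ ∈ φ.range
    rw [LieHom.map_lie, leibniz_lie]
    exact add_mem (φ.range.lie_mem hk (φ.mem_range_self l))
      (φ.range.lie_mem (φ.mem_range_self k) hl)

/-- The ideal `I` of `L` absorbs `m ∈ M` into `L`, where `L` is mapped to `M` by `φ`. -/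
def Absorbs (φ : L →ₗ⁅Φ⁆ M) (I : LieIdeal Φ L) (m : M) : Prop :=
  ∀ k ∈ I, k ∈ absorber φ m

variable {φ : L →ₗ⁅Φ⁆ M}

theorem mem_absorber {m : M} {k : L} : k ∈ absorber φ m ↔ ∃ l, φ l = ⁅m, φ k⁆ := Iff.rfl

theorem Absorbs.mono {I J : LieIdeal Φ L} {m : M} (h : Absorbs φ I m) (hJ : J ≤ I) :
    Absorbs φ J m := fun k hk => h k (hJ hk)

theorem Absorbs.exists_mem {I : LieIdeal Φ L} {m : M} (h : Absorbs φ I m) {k : L}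
    (hk : k ∈ ⁅I, I⁆) : ∃ l ∈ I, φ l = ⁅m, φ k⁆ := by
  suffices hle : (⁅I, I⁆ : LieIdeal Φ L).toSubmodule ≤
      ((I.toSubmodule.map φ.toLinearMap).comap (LieModule.toEnd Φ M M m)).comap φ.toLinearMap from
    hle hk
  refine toSubmodule_lie_le_iff.mpr fun a ha b hb => ?_
  obtain ⟨a', ha'⟩ := mem_absorber.mp (h a ha)
  obtain ⟨b', hb'⟩ := mem_absorber.mp (h b hb)
  refine ⟨⁅a', b⁆ + ⁅a, b'⁆, add_mem (lie_mem_right Φ L I _ _ hb) (lie_mem_left Φ L I _ _ ha), ?_⟩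
  change φ (⁅a', b⁆ + ⁅a, b'⁆) = ⁅m, φ ⁅a, b⁆⁆
  rw [map_add, LieHom.map_lie, LieHom.map_lie, LieHom.map_lie, leibniz_lie, ha', hb']

theorem absorbs_lie_self_of_absorber_eq_top {I : LieIdeal Φ L} {m : M}
    (h : ∀ k ∈ I, absorber φ ⁅m, φ k⁆ = ⊤) : Absorbs φ ⁅I, I⁆ m := by
  suffices hle : (⁅I, I⁆ : LieIdeal Φ L).toSubmodule ≤ (absorber φ m).toSubmodule from
    fun k hk => hle hk
  refine toSubmodule_lie_le_iff.mpr fun a ha b hb => ?_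
  obtain ⟨c, hc⟩ := mem_absorber.mp ((h a ha).symm ▸ LieSubalgebra.mem_top b)
  obtain ⟨d, hd⟩ := mem_absorber.mp ((h b hb).symm ▸ LieSubalgebra.mem_top a)
  refine ⟨c - d, ?_⟩
  change φ (c - d) = ⁅m, φ ⁅a, b⁆⁆
  rw [map_sub, hc, hd, LieHom.map_lie, leibniz_lie, ← lie_skew (φ a), sub_eq_add_neg]

variable (hφ : Function.Injective φ)

/-- The derivation `φ⁻¹ ∘ ad m ∘ φ`, defined on an ideal that absorbs `m`. -/
noncomputable def Absorbs.der {I : LieIdeal Φ L} {m : M} (h : Absorbs φ I m) : PDer I :=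
  ⟨(LinearEquiv.ofInjective φ.toLinearMap hφ).symm ∘ₗ
      (LieModule.toEnd Φ M M m ∘ₗ φ.toLinearMap ∘ₗ I.toSubmodule.subtype).codRestrict
        (LinearMap.range φ.toLinearMap) fun k => h k k.2, fun k l => hφ <| by
    have map_δ (k : I) := congrArg Subtype.val
      ((LinearEquiv.ofInjective φ.toLinearMap hφ).apply_symm_apply ⟨⁅m, φ k⁆, h k k.2⟩)
    rw [map_add, LieHom.map_lie, LieHom.map_lie]
    refine (map_δ ⁅k, l⁆).trans (Eq.trans ?_ (congrArg₂ (fun u v => ⁅u, φ l⁆ + ⁅φ k, v⁆)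
      (map_δ k) (map_δ l)).symm)
    exact (congrArg _ (LieHom.map_lie φ k l)).trans (leibniz_lie _ _ _)⟩

theorem Absorbs.map_der {I : LieIdeal Φ L} {m : M} (h : Absorbs φ I m) {k : L} (hk : k ∈ I) :
    φ ((h.der hφ).1 ⟨k, hk⟩) = ⁅m, φ k⁆ :=
  congrArg Subtype.val ((LinearEquiv.ofInjective φ.toLinearMap hφ).apply_symm_apply _)

variable [Semiprime Φ L]

/-- The elements of `M` that are absorbed into `L` by an essential ideal of `L`. -/
def absorbed (φ : L →ₗ⁅Φ⁆ M) : LieSubalgebra Φ M where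
  carrier := {m | ∃ I : LieIdeal Φ L, IsEssential I ∧ Absorbs φ I m}
  zero_mem' := ⟨⊤, IsEssential.top, fun k _ => mem_absorber.mpr ⟨0, by rw [map_zero, zero_lie]⟩⟩
  add_mem' := by
    rintro m n ⟨I, hI, hm⟩ ⟨J, hJ, hn⟩
    refine ⟨I ⊓ J, hI.inf hJ, fun k hk => mem_absorber.mpr ?_⟩
    obtain ⟨a, ha⟩ := mem_absorber.mp (hm.mono inf_le_left k hk)
    obtain ⟨b, hb⟩ := mem_absorber.mp (hn.mono inf_le_right k hk)
    exact ⟨a + b, by rw [map_add, ha, hb, add_lie]⟩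
  smul_mem' := by
    rintro c m ⟨I, hI, hm⟩
    refine ⟨I, hI, fun k hk => mem_absorber.mpr ?_⟩
    obtain ⟨a, ha⟩ := mem_absorber.mp (hm k hk)
    exact ⟨c • a, by rw [map_smul, ha, smul_lie]⟩
  lie_mem' := by
    rintro m n ⟨I, hI, hm⟩ ⟨J, hJ, hn⟩
    refine ⟨_, (hI.inf hJ).lie_self, fun k hk => mem_absorber.mpr ?_⟩
    obtain ⟨a, haI, ha⟩ := (hm.mono inf_le_left).exists_mem hk
    obtain ⟨b, hbI, hb⟩ := (hn.mono inf_le_right).exists_mem hk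
    obtain ⟨a', ha'⟩ := mem_absorber.mp (hn.mono inf_le_right a haI)
    obtain ⟨b', hb'⟩ := mem_absorber.mp (hm.mono inf_le_left b hbI)
    exact ⟨b' - a', by rw [map_sub, ha', hb', ha, hb, lie_lie]⟩

/-- The element of `Q_m(L)` given by `φ⁻¹ ∘ ad m ∘ φ` on an essential ideal that absorbs `m`. -/
noncomputable def absorbedToQm (m : absorbed φ) : Qm Φ L :=
  Qm.mk m.2.choose_spec.1 (m.2.choose_spec.2.der hφ)

theorem absorbedToQm_lie_of (m : absorbed φ) {k l : L} (hl : φ l = ⁅(m : M), φ k⁆) :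
    ⁅absorbedToQm hφ m, Qm.of Φ L k⁆ = Qm.of Φ L l := by
  have hI := m.2.choose_spec.1
  have lie_of {x y : L} (hx : x ∈ m.2.choose) (hy : φ y = ⁅(m : M), φ x⁆) :
      ⁅absorbedToQm hφ m, Qm.of Φ L x⁆ = Qm.of Φ L y := by
    rw [absorbedToQm, Qm.mk_lie_of hI _ hx]
    congr 1
    exact hφ ((m.2.choose_spec.2.map_der hφ hx).trans hy.symm)
  refine Qm.ext_of_lie_of hI fun x hx => ?_
  obtain ⟨y, hy⟩ := mem_absorber.mp (m.2.choose_spec.2 x hx)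
  have hxy : φ (⁅l, x⁆ + ⁅k, y⁆) = ⁅(m : M), φ ⁅k, x⁆⁆ := by
    rw [map_add, LieHom.map_lie, LieHom.map_lie, LieHom.map_lie, hl, hy, ← leibniz_lie]
  rw [lie_lie, lie_of hx hy, ← Qm.of_lie, lie_of (lie_mem_right Φ L _ k x hx) hxy, map_add,
    ← Qm.of_lie, ← Qm.of_lie, add_sub_cancel_right]

theorem eq_absorbedToQm {m : absorbed φ} {I : LieIdeal Φ L} (hI : IsEssential I) {q : Qm Φ L}
    (h : ∀ k ∈ I, ∀ l, φ l = ⁅(m : M), φ k⁆ → ⁅q, Qm.of Φ L k⁆ = Qm.of Φ L l) :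
    absorbedToQm hφ m = q := by
  obtain ⟨J, hJ, hm⟩ := m.2
  refine Qm.ext_of_lie_of (hI.inf hJ) fun k hk => ?_
  obtain ⟨hkI, hkJ⟩ := (LieSubmodule.mem_inf _ _ _).mp hk
  obtain ⟨l, hl⟩ := mem_absorber.mp (hm k hkJ)
  rw [absorbedToQm_lie_of hφ m hl, h k hkI l hl]

/-- The homomorphism `m ↦ φ⁻¹ ∘ ad m ∘ φ` from the elements of `M` that are absorbed into `L` to
`Q_m(L)`. -/
noncomputable def toQm : absorbed φ →ₗ⁅Φ⁆ Qm Φ L where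
  toFun := absorbedToQm hφ
  map_add' m n := by
    obtain ⟨I, hI, hm⟩ := m.2
    refine eq_absorbedToQm hφ hI fun k hk l hl => ?_
    obtain ⟨a, ha⟩ := mem_absorber.mp (hm k hk)
    have hb : φ (l - a) = ⁅(n : M), φ k⁆ := by
      rw [map_sub, hl, ha]
      exact sub_eq_of_eq_add' (add_lie (m : M) n (φ k))
    rw [add_lie, absorbedToQm_lie_of hφ m ha, absorbedToQm_lie_of hφ n hb, ← map_add,
      add_sub_cancel]
  map_smul' c m := by
    obtain ⟨I, hI, hm⟩ := m.2
    refine eq_absorbedToQm hφ hI fun k hk l hl => ?_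
    obtain ⟨a, ha⟩ := mem_absorber.mp (hm k hk)
    rw [RingHom.id_apply, smul_lie, absorbedToQm_lie_of hφ m ha, ← map_smul]
    congr 1
    refine hφ ?_
    rw [hl, map_smul, ha]
    exact (smul_lie c (m : M) (φ k)).symm
  map_lie' {m n} := by
    obtain ⟨I, hI, hm⟩ := m.2
    obtain ⟨J, hJ, hn⟩ := n.2
    refine eq_absorbedToQm hφ (hI.inf hJ).lie_self fun k hk l hl => ?_
    obtain ⟨a, haI, ha⟩ := (hm.mono inf_le_left).exists_mem hk
    obtain ⟨b, hbI, hb⟩ := (hn.mono inf_le_right).exists_mem hk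
    obtain ⟨a', ha'⟩ := mem_absorber.mp (hn.mono inf_le_right a haI)
    obtain ⟨b', hb'⟩ := mem_absorber.mp (hm.mono inf_le_left b hbI)
    rw [lie_lie, absorbedToQm_lie_of hφ m ha, absorbedToQm_lie_of hφ n hb,
      absorbedToQm_lie_of hφ n ha', absorbedToQm_lie_of hφ m hb', ← map_sub]
    congr 1
    refine hφ ?_
    rw [hl, map_sub, ha', hb', ha, hb]
    exact (lie_lie (m : M) n (φ k)).symm

theorem toQm_lie_of (m : absorbed φ) {k l : L} (hl : φ l = ⁅(m : M), φ k⁆) :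
    ⁅toQm hφ m, Qm.of Φ L k⁆ = Qm.of Φ L l :=
  absorbedToQm_lie_of hφ m hl

theorem toQm_eq_mk (m : absorbed φ) {I : LieIdeal Φ L} (hI : IsEssential I)
    (h : Absorbs φ I (m : M)) : toQm hφ m = Qm.mk hI (h.der hφ) :=
  eq_absorbedToQm hφ hI fun k hk l hl => by
    rw [Qm.mk_lie_of hI _ hk]
    congr 1
    exact hφ ((h.map_der hφ hk).trans hl.symm)

theorem toQm_of_eq {m : absorbed φ} {l : L} (h : φ l = m) : toQm hφ m = Qm.of Φ L l :=
  eq_absorbedToQm hφ IsEssential.top fun k _ l' hl' => by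
    rw [← Qm.of_lie]
    congr 1
    exact hφ (by rw [hl', LieHom.map_lie, h])

theorem map_mem_absorbed {e : L ≃ₗ⁅Φ⁆ L} {e' : M ≃ₗ⁅Φ⁆ M} (he : ∀ l, φ (e l) = e' (φ l)) {m : M}
    (hm : m ∈ absorbed φ) : e' m ∈ absorbed φ := by
  obtain ⟨I, hI, h⟩ := hm
  refine ⟨_, hI.comap e, fun k (hk : e.symm k ∈ I) => ?_⟩
  obtain ⟨l, hl⟩ := mem_absorber.mp (h _ hk)
  refine mem_absorber.mpr ⟨e l, ?_⟩
  rw [he, hl, LieEquiv.map_lie, ← he, e.apply_symm_apply]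

theorem conj_toQm {e : L ≃ₗ⁅Φ⁆ L} {e' : M ≃ₗ⁅Φ⁆ M} (he : ∀ l, φ (e l) = e' (φ l))
    (m : absorbed φ) :
    Qm.conj e (toQm hφ m) = toQm hφ ⟨e' m, map_mem_absorbed he m.2⟩ := by
  obtain ⟨I, hI, _⟩ := m.2
  refine (eq_absorbedToQm hφ (hI.comap e) fun k hk l hl => ?_).symm
  obtain ⟨k, rfl⟩ : ∃ l, e l = k := ⟨_, e.apply_symm_apply k⟩
  obtain ⟨l, rfl⟩ : ∃ l', e l' = l := ⟨_, e.apply_symm_apply l⟩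
  have hl' : φ l = ⁅(m : M), φ k⁆ := e'.injective <| by
    change e' (φ l) = e' ⁅(m : M), φ k⁆
    rw [← he, hl, he, LieEquiv.map_lie]
  rw [← Qm.conj_of, ← Qm.conj_of, ← toQm_lie_of hφ m hl', Qm.conj_lie]

end Extension

section Graded

variable {Φ L G : Type*} [CommRing Φ] [LieRing L] [LieAlgebra Φ L]
  [AddCommGroup G] [DecidableEq G] {ℒ : G → Submodule Φ L} [GradedLieAlgebra ℒ]

theorem decompose_mem {N : Submodule Φ L} {i j : G} {a : L} (ha : a ∈ N) (hi : a ∈ ℒ i) :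
    (DirectSum.decompose ℒ a j : L) ∈ N := by
  by_cases hij : i = j
  · rwa [← hij, DirectSum.decompose_of_mem_same ℒ hi]
  · rw [DirectSum.decompose_of_mem_ne ℒ hi hij]
    exact zero_mem N

theorem isHomogeneous_inf {I J : LieIdeal Φ L} (hI : DirectSum.SetLike.IsHomogeneous ℒ I)
    (hJ : DirectSum.SetLike.IsHomogeneous ℒ J) :
    DirectSum.SetLike.IsHomogeneous ℒ (I ⊓ J : LieIdeal Φ L) := fun i _ hm =>
  have hm' := (LieSubmodule.mem_inf _ _ _).mp hm
  (LieSubmodule.mem_inf _ _ _).mpr ⟨hI i hm'.1, hJ i hm'.2⟩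

theorem isHomogeneous_lie {I J : LieIdeal Φ L} (hI : DirectSum.SetLike.IsHomogeneous ℒ I)
    (hJ : DirectSum.SetLike.IsHomogeneous ℒ J) :
    DirectSum.SetLike.IsHomogeneous ℒ (⁅I, J⁆ : LieIdeal Φ L) := fun i m hm => by
  classical
  suffices hle : (⁅I, J⁆ : LieIdeal Φ L).toSubmodule ≤
      (⁅I, J⁆ : LieIdeal Φ L).toSubmodule.comap ((ℒ i).subtype ∘ₗ
        DirectSum.component Φ G (fun i => ℒ i) i ∘ₗ
          (DirectSum.decomposeLinearEquiv ℒ).toLinearMap) from hle hm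
  refine toSubmodule_lie_le_iff.mpr fun a ha b hb => ?_
  rw [← DirectSum.sum_support_decompose ℒ a, ← DirectSum.sum_support_decompose ℒ b, sum_lie]
  refine sum_mem fun k _ => ?_
  rw [lie_sum]
  refine sum_mem fun l _ => ?_
  exact decompose_mem (LieSubmodule.lie_mem_lie (hI k ha) (hJ l hb))
    (SetLike.GradedBracket.bracket_mem (SetLike.coe_mem _) (SetLike.coe_mem _))

theorem IsEssential.eq_zero_of_lie_homogeneous [Semiprime Φ L] {I : LieIdeal Φ L}
    (hI : IsEssential I) (gI : DirectSum.SetLike.IsHomogeneous ℒ I) {c : L}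
    (hc : ∀ i, ∀ k ∈ I, k ∈ ℒ i → ⁅c, k⁆ = 0) : c = 0 := by
  classical
  refine hI.eq_zero_of_lie fun k hk => ?_
  rw [← DirectSum.sum_support_decompose ℒ k, lie_sum]
  exact Finset.sum_eq_zero fun i _ => hc i _ (gI i hk) (SetLike.coe_mem _)

namespace Qm

theorem eq_zero_of_lie_homogeneous [Semiprime Φ L] {I : LieIdeal Φ L} (hI : IsEssential I)
    (gI : DirectSum.SetLike.IsHomogeneous ℒ I) {q : Qm Φ L}
    (hq : ∀ i, ∀ k ∈ I, k ∈ ℒ i → ⁅q, of Φ L k⁆ = 0) : q = 0 := by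
  classical
  refine ext_of_lie_of hI fun k hk => ?_
  rw [zero_lie, ← DirectSum.sum_support_decompose ℒ k, map_sum, lie_sum]
  exact Finset.sum_eq_zero fun i _ => hq i _ (gI i hk) (SetLike.coe_mem _)

theorem exists_lie_of_eq_of_mem_component [Semiprime Φ L] {σ : G} {q : Qm Φ L}
    (hq : q ∈ component ℒ σ) : ∃ I : LieIdeal Φ L, IsEssential I ∧
      DirectSum.SetLike.IsHomogeneous ℒ I ∧ ∀ τ, ∀ k ∈ I, k ∈ ℒ τ →
        ∃ l ∈ ℒ (τ + σ), ⁅q, of Φ L k⁆ = of Φ L l ∧ (k ∈ ⁅I, I⁆ → l ∈ I) := by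
  obtain ⟨I, hI, δ, gI, hδ, rfl⟩ := hq
  exact ⟨I, hI, gI, fun τ k hk hkτ =>
    ⟨_, hδ τ ⟨k, hk⟩ hkτ, mk_lie_of hI δ hk, fun hk' => PDer.apply_mem δ hk' hk⟩⟩

theorem lie_mem_component [Semiprime Φ L] {σ ρ : G} {p q : Qm Φ L}
    (hp : p ∈ component ℒ σ) (hq : q ∈ component ℒ ρ) : ⁅p, q⁆ ∈ component ℒ (σ + ρ) := by
  obtain ⟨I, hI, δ, gI, hδ, rfl⟩ := hp
  obtain ⟨J, hJ, μ, gJ, hμ, rfl⟩ := hq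
  rw [← mk_restrict hI (hI.inf hJ) inf_le_left, ← mk_restrict hJ (hI.inf hJ) inf_le_right, mk_lie]
  have gK := isHomogeneous_inf gI gJ
  refine ⟨_, _, _, isHomogeneous_lie gK gK, fun τ x hx => ?_, rfl⟩
  obtain ⟨x, hx'⟩ := x
  have hδ' (τ : G) (y : (I ⊓ J : LieIdeal Φ L)) (hy : (y : L) ∈ ℒ τ) :
      (PDer.restrict inf_le_left δ).1 y ∈ ℒ (τ + σ) := hδ τ _ hy
  have hμ' (τ : G) (y : (I ⊓ J : LieIdeal Φ L)) (hy : (y : L) ∈ ℒ τ) :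
      (PDer.restrict inf_le_right μ).1 y ∈ ℒ (τ + ρ) := hμ τ _ hy
  rw [PDer.bracket_apply]
  refine sub_mem ?_ ?_
  · rw [add_comm σ, ← add_assoc]
    exact hδ' _ _ (hμ' τ _ hx)
  · rw [← add_assoc]
    exact hμ' _ _ (hδ' τ _ hx)

theorem conj_mem_component {e : L ≃ₗ⁅Φ⁆ L} (he : ∀ n a, e a ∈ ℒ n ↔ a ∈ ℒ (-n)) {σ : G}
    {p : Qm Φ L} (hp : p ∈ component ℒ σ) : conj e p ∈ component ℒ (-σ) := by
  have he' (n : G) (a : L) : e.symm a ∈ ℒ (-n) ↔ a ∈ ℒ n := by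
    rw [← he, e.apply_symm_apply]
  obtain ⟨I, hI, δ, gI, hδ, rfl⟩ := hp
  refine ⟨_, hI.comap e, PDer.conj e δ, fun i x hx => ?_, fun τ x hx => ?_, rfl⟩
  · suffices h : (DirectSum.decompose ℒ (e.symm x) (-i) : L) = e.symm (DirectSum.decompose ℒ x i) by
      change e.symm (DirectSum.decompose ℒ x i) ∈ I
      exact h ▸ gI (-i) hx
    refine DirectSum.Decomposition.inductionOn ℒ ?_ (fun {j} y => ?_) (fun y z hy hz => ?_) x
    · simp only [map_zero, DirectSum.decompose_zero, DirectSum.zero_apply, ZeroMemClass.coe_zero]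
    · by_cases hij : j = i
      · rw [← hij, DirectSum.decompose_of_mem_same ℒ y.2,
          DirectSum.decompose_of_mem_same ℒ ((he' j y).mpr y.2)]
      · rw [DirectSum.decompose_of_mem_ne ℒ y.2 hij, map_zero,
          DirectSum.decompose_of_mem_ne ℒ ((he' j y).mpr y.2) (fun h => hij (neg_injective h))]
    · simp only [map_add, DirectSum.decompose_add, DirectSum.add_apply, Submodule.coe_add, hy, hz]
  · have h := hδ (-τ) ⟨e.symm x, x.2⟩ ((he' τ x).mpr hx)
    change e (δ.1 ⟨e.symm x, x.2⟩) ∈ ℒ (τ + -σ)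
    rwa [he, neg_add, neg_neg]

end Qm

end Graded

/-! ### Nondegenerate 3-gradings -/

section Polarization

variable {Φ A B : Type*} [CommRing Φ] [AddCommGroup A] [Module Φ A] [AddCommGroup B] [Module Φ B]

theorem symm_trilinear_eq_zero_of_cube (h6 : IsUnit (6 : Φ)) {F : A →ₗ[Φ] A →ₗ[Φ] A →ₗ[Φ] B}
    (h12 : ∀ x y z, F x y z = F y x z) (h23 : ∀ x y z, F x y z = F x z y)
    (hF : ∀ y, F y y y = 0) (x y z : A) : F x y z = 0 := by
  refine h6.smul_eq_zero.mp ?_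
  have polarization : (6 : Φ) • F x y z = F (x + y + z) (x + y + z) (x + y + z)
      - F (x + y) (x + y) (x + y) - F (x + z) (x + z) (x + z) - F (y + z) (y + z) (y + z)
      + F x x x + F y y y + F z z z := by
    simp only [map_add, LinearMap.add_apply, h12 y x, h12 z x, h12 z y, h23 _ y x, h23 _ z x,
      h23 _ z y]
    module
  simp only [polarization, hF, sub_zero, add_zero]

end Polarization

section JordanIdentity

theorem mul_mul_mul_eq_of_lie_lie_lie_eq_zero {R : Type*} [Ring R]
    (h3 : ∀ a : R, 3 • a = 0 → a = 0) {X W : R} (hX : X * X * X = 0)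
    (hXW : ⁅X, ⁅X, ⁅X, W⁆⁆⁆ = 0) : X * X * W * X = X * W * X * X := by
  refine sub_eq_zero.mp (h3 _ ?_)
  have h : 3 • (X * X * W * X - X * W * X * X) =
      X * X * X * W - W * (X * X * X) - ⁅X, ⁅X, ⁅X, W⁆⁆⁆ := by
    simp only [Ring.lie_def]
    noncomm_ring
  rw [h, hXW, hX, zero_mul, mul_zero, sub_zero, sub_zero]

-- For `X = ad x`, `W = ad n`: the fundamental formula `Q(Q(x)n) = Q(x)Q(n)Q(x)`, `Q(x) = (ad x)²`.
theorem lie_lie_mul_self {R : Type*} [Ring R] (h3 : ∀ a : R, 3 • a = 0 → a = 0) {X W : R}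
    (hX : X * X * X = 0) (hXW : ⁅X, ⁅X, ⁅X, W⁆⁆⁆ = 0) :
    ⁅X, ⁅X, W⁆⁆ * ⁅X, ⁅X, W⁆⁆ = X * X * W * W * X * X := by
  have hcomm := mul_mul_mul_eq_of_lie_lie_lie_eq_zero h3 hX hXW
  have hXXWXX : X * X * W * X * X = 0 := by
    rw [hcomm, mul_assoc, mul_assoc, ← mul_assoc X X X, hX, mul_zero]
  have hmid : X * W * X * W * X * X = X * W * X * X * W * X := by
    have h := congrArg (X * W * ·) hcomm
    simp only [mul_assoc] at h ⊢
    exact h.symm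
  have hleft : X * X * W * X * W * X = X * W * X * X * W * X := by rw [hcomm]
  have expand : ⁅X, ⁅X, W⁆⁆ * ⁅X, ⁅X, W⁆⁆ = X * X * W * W * X * X
      + (4 • (X * W * X * X * W * X) - 2 • (X * X * W * X * W * X) - 2 • (X * W * X * W * X * X))
      + X * X * W * X * X * W + W * (X * X * W * X * X)
      - 2 • (X * W * (X * X * X) * W) - 2 • (W * (X * X * X) * W * X)
      + W * (X * X * X) * X * W := by
    simp only [Ring.lie_def]
    noncomm_ring
  rw [expand, hXXWXX, hX, hmid, hleft]
  simp only [mul_zero, zero_mul, smul_zero, add_zero, sub_zero]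
  module

end JordanIdentity

section DegreeTwo

variable {Φ L : Type*} [CommRing Φ] [LieRing L] [LieAlgebra Φ L]

theorem lie_lie_cube_eq_zero (h2 : IsUnit (2 : Φ)) {q y u : L} (hu : u = ⁅⁅⁅q, y⁆, y⁆, y⁆)
    (hyu : ⁅y, u⁆ = 0) (hq : ⁅q, ⁅⁅q, y⁆, y⁆⁆ = 0) : ⁅⁅q, u⁆, u⁆ = 0 := by
  set D := ⁅⁅q, y⁆, y⁆ with hD
  have huy : ⁅u, y⁆ = 0 := by rw [← lie_skew, hyu, neg_zero]
  have lie_D_qy : ⁅D, ⁅q, y⁆⁆ = ⁅q, u⁆ := by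
    rw [leibniz_lie, ← lie_skew D q, hq, neg_zero, zero_lie, zero_add, hu]
  have hE : ⁅⁅q, y⁆, u⁆ = 0 := by
    refine h2.smul_eq_zero.mp ?_
    calc (2 : Φ) • ⁅⁅q, y⁆, u⁆ = ⁅⁅q, u⁆, y⁆ + ⁅⁅q, y⁆, u⁆ := by
          rw [two_smul, lie_lie q u y, huy, lie_zero, zero_sub, lie_skew]
      _ = ⁅D, ⁅⁅q, y⁆, y⁆⁆ := by rw [leibniz_lie D, lie_D_qy, hu]
      _ = 0 := lie_self D
  have hDu : ⁅D, u⁆ = 0 := by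
    rw [hD, lie_lie, hyu, lie_zero, zero_sub, hE, lie_zero, neg_zero]
  calc ⁅⁅q, u⁆, u⁆ = ⁅D, ⁅⁅q, y⁆, u⁆⁆ := by rw [leibniz_lie D, lie_D_qy, hDu, lie_zero, add_zero]
    _ = 0 := by rw [hE, lie_zero]

theorem lie_lie_lie_comm {q x y z : L} (hyz : ⁅y, z⁆ = 0) :
    ⁅⁅⁅q, x⁆, y⁆, z⁆ = ⁅⁅⁅q, x⁆, z⁆, y⁆ := by
  rw [lie_lie, hyz, lie_zero, zero_sub, lie_skew]

theorem lie_eq_zero_of_degree_two (h6 : IsUnit (6 : Φ)) {q : L} {A : Submodule Φ L}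
    (hA : ∀ x ∈ A, ∀ y ∈ A, ⁅x, y⁆ = 0) (hS : ∀ x ∈ A, ∀ y ∈ A, ∀ z ∈ A, ⁅⁅⁅q, x⁆, y⁆, z⁆ ∈ A)
    (hqA : ∀ x ∈ A, ∀ y ∈ A, ⁅⁅q, x⁆, ⁅q, y⁆⁆ = 0) (hqq : ∀ x ∈ A, ⁅q, ⁅q, x⁆⁆ = 0)
    (hnd : ∀ y ∈ A, (∀ w ∈ A, ⁅⁅⁅q, y⁆, w⁆, ⁅q, y⁆⁆ = 0) → ⁅q, y⁆ = 0) : ∀ y ∈ A, ⁅q, y⁆ = 0 := by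
  have h2 : IsUnit (2 : Φ) := isUnit_of_mul_isUnit_left (y := 3) (by norm_num [h6])
  have lie_q {x y : L} (hx : x ∈ A) (hy : y ∈ A) : ⁅q, ⁅⁅q, x⁆, y⁆⁆ = 0 := by
    rw [leibniz_lie, hqq x hx, zero_lie, zero_add, hqA x hx y hy]
  have lie_q_S {x y z : L} (hx : x ∈ A) (hy : y ∈ A) :
      ⁅q, ⁅⁅⁅q, x⁆, y⁆, z⁆⁆ = ⁅⁅⁅q, x⁆, y⁆, ⁅q, z⁆⁆ := by
    rw [leibniz_lie, lie_q hx hy, zero_lie, zero_add]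
  have hcube (y : L) (hy : y ∈ A) : ⁅q, ⁅⁅⁅q, y⁆, y⁆, y⁆⁆ = 0 := by
    have hu := hS y hy y hy y hy
    refine hnd _ hu fun w hw => ?_
    rw [← lie_q_S hu hw, lie_lie_lie_comm (hA w hw _ hu),
      lie_lie_cube_eq_zero h2 rfl (hA y hy _ hu) (lie_q hy hy), zero_lie, lie_zero]
  let F : A →ₗ[Φ] A →ₗ[Φ] A →ₗ[Φ] L := LinearMap.mk₂ Φ (fun x y =>
      LieModule.toEnd Φ L L q ∘ₗ LieModule.toEnd Φ L L ⁅⁅q, (x : L)⁆, (y : L)⁆ ∘ₗ A.subtype)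
    (fun _ _ _ => by ext; simp) (fun _ _ _ => by ext; simp) (fun _ _ _ => by ext; simp)
    (fun _ _ _ => by ext; simp)
  have hF (x y z : A) : F x y z = 0 := by
    refine symm_trilinear_eq_zero_of_cube h6 (fun x y z => ?_) (fun x y z => ?_)
      (fun y : A => hcube y y.2) x y z
    · change ⁅q, ⁅⁅⁅q, (x : L)⁆, (y : L)⁆, (z : L)⁆⁆ = ⁅q, ⁅⁅⁅q, (y : L)⁆, (x : L)⁆, (z : L)⁆⁆
      rw [lie_lie q (x : L), hA x x.2 y y.2, lie_zero, zero_sub, lie_skew]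
    · exact congrArg _ (lie_lie_lie_comm (hA y y.2 z z.2))
  refine fun y hy => hnd y hy fun w hw => ?_
  rw [← lie_q_S hy hw]
  exact hF ⟨y, hy⟩ ⟨w, hw⟩ ⟨y, hy⟩

end DegreeTwo

section ThreeGraded

attribute [local instance] LieRing.ofAssociativeRing

variable {Φ L : Type*} [CommRing Φ] [LieRing L] [LieAlgebra Φ L]

/-- `L` is 3-graded by `ℒ`, that is, `L = L₋₁ ⊕ L₀ ⊕ L₁`, and no nonzero `x ∈ L₁` has
`[x, [x, L₋₁]] = 0`. -/
structure IsNondegenerateThreeGrading (ℒ : ℤ → Submodule Φ L) : Prop where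
  eq_zero {n : ℤ} {a : L} : a ∈ ℒ n → n < -1 ∨ 1 < n → a = 0
  nondegenerate {x : L} : x ∈ ℒ 1 → (∀ y ∈ ℒ (-1), ⁅x, ⁅x, y⁆⁆ = 0) → x = 0

namespace IsNondegenerateThreeGrading

variable {ℒ : ℤ → Submodule Φ L} [GradedLieAlgebra ℒ]

theorem lie_eq_zero (h : IsNondegenerateThreeGrading ℒ) {m n : ℤ} {a b : L} (ha : a ∈ ℒ m)
    (hb : b ∈ ℒ n) (hmn : m + n < -1 ∨ 1 < m + n) : ⁅a, b⁆ = 0 :=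
  h.eq_zero (SetLike.GradedBracket.bracket_mem ha hb) hmn

theorem ad_cube_eq_zero (h : IsNondegenerateThreeGrading ℒ) {x : L} (hx : x ∈ ℒ 1) :
    LieAlgebra.ad Φ L x * LieAlgebra.ad Φ L x * LieAlgebra.ad Φ L x = 0 := by
  refine DirectSum.decompose_lhom_ext ℒ fun i => LinearMap.ext fun a => ?_
  change ⁅x, ⁅x, ⁅x, (a : L)⁆⁆⁆ = 0
  by_cases hi : i < -1
  · rw [h.eq_zero a.2 (Or.inl hi), lie_zero, lie_zero, lie_zero]
  · refine h.lie_eq_zero hx (SetLike.GradedBracket.bracket_mem hx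
      (SetLike.GradedBracket.bracket_mem hx a.2)) ?_
    lia

theorem eq_zero_of_lie_lie (h : IsNondegenerateThreeGrading ℒ) (h3 : IsUnit (3 : Φ))
    {K : LieIdeal Φ L} {x : L} (hxK : x ∈ K) (hx : x ∈ ℒ 1)
    (hKK : ∀ y ∈ ⁅K, K⁆, y ∈ ℒ (-1) → ⁅x, ⁅x, y⁆⁆ = 0) : x = 0 := by
  refine h.nondegenerate hx fun n hn => h.nondegenerate (by
    simpa using SetLike.GradedBracket.bracket_mem hx (SetLike.GradedBracket.bracket_mem hx hn))
    fun z hz => ?_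
  have hX := h.ad_cube_eq_zero hx
  have sq_ad := lie_lie_mul_self (fun a ha => h3.smul_eq_zero.mp (by
      rwa [← Nat.cast_smul_eq_nsmul Φ] at ha)) hX (W := LieAlgebra.ad Φ L n) <| by
    rw [← LieHom.map_lie, ← LieHom.map_lie, ← LieHom.map_lie,
      show ⁅x, ⁅x, ⁅x, n⁆⁆⁆ = 0 from LinearMap.congr_fun hX n, map_zero]
  rw [← LieHom.map_lie, ← LieHom.map_lie] at sq_ad
  refine (LinearMap.congr_fun sq_ad z).trans ?_
  change ⁅x, ⁅x, ⁅n, ⁅n, ⁅x, ⁅x, z⁆⁆⁆⁆⁆⁆ = 0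
  refine hKK _ ?_ ?_
  · exact lie_mem_right Φ L _ _ _ (lie_mem_right Φ L _ _ _
      (LieSubmodule.lie_mem_lie hxK (lie_mem_left Φ L K _ _ hxK)))
  · simpa using SetLike.GradedBracket.bracket_mem hn (SetLike.GradedBracket.bracket_mem hn
      (SetLike.GradedBracket.bracket_mem hx (SetLike.GradedBracket.bracket_mem hx hz)))

theorem eq_zero_of_lie_ideal [Semiprime Φ L] (h : IsNondegenerateThreeGrading ℒ)
    (h3 : IsUnit (3 : Φ)) {K : LieIdeal Φ L} (hK : IsEssential K)
    (gK : DirectSum.SetLike.IsHomogeneous ℒ K) {z : L} (hz : z ∈ ℒ 1)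
    (hzK : ∀ y ∈ K, y ∈ ℒ (-1) → ⁅z, y⁆ = 0) : z = 0 := by
  refine hK.eq_zero_of_lie_homogeneous gK fun i k hk hki => ?_
  by_cases hi : i = -1
  · exact hzK k hk (hi ▸ hki)
  by_cases hi0 : i = 0
  · subst hi0
    have hzk : ⁅z, k⁆ ∈ ℒ 1 := by simpa using SetLike.GradedBracket.bracket_mem hz hki
    refine h.eq_zero_of_lie_lie h3 (lie_mem_right Φ L K z k hk) hzk fun y hy hy1 => ?_
    have hky : ⁅k, y⁆ ∈ ℒ (-1) := by simpa using SetLike.GradedBracket.bracket_mem hki hy1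
    rw [lie_lie z k y, hzK y (lie_self_le K hy) hy1, hzK _ (lie_mem_left Φ L K k y hk) hky,
      lie_zero, sub_zero, lie_zero]
  · by_cases hi' : i < -1
    · rw [h.eq_zero hki (Or.inl hi'), lie_zero]
    · exact h.lie_eq_zero hz hki (by lia)

theorem lie_of_eq_zero_of_degree_two [Semiprime Φ L] (h : IsNondegenerateThreeGrading ℒ)
    (h6 : IsUnit (6 : Φ)) {I : LieIdeal Φ L} {q : Qm Φ L}
    (hq : ∀ i, ∀ k ∈ I, k ∈ ℒ i → ∃ l ∈ ℒ (i + 2),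
      ⁅q, Qm.of Φ L k⁆ = Qm.of Φ L l ∧ (k ∈ ⁅I, I⁆ → l ∈ I)) {y : L} (hy : y ∈ ⁅I, I⁆)
    (hy1 : y ∈ ℒ (-1)) : ⁅q, Qm.of Φ L y⁆ = 0 := by
  have h3 : IsUnit (3 : Φ) := isUnit_of_mul_isUnit_left (y := 2) (by norm_num [h6])
  have hlie (k : L) (hk : k ∈ ⁅I, I⁆) (hk1 : k ∈ ℒ (-1)) :
      ∃ l ∈ I, l ∈ ℒ 1 ∧ ⁅q, Qm.of Φ L k⁆ = Qm.of Φ L l := by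
    obtain ⟨l, hl1, hl, hlI⟩ := hq (-1) k (lie_self_le I hk) hk1
    exact ⟨l, hlI hk, hl1, hl⟩
  refine lie_eq_zero_of_degree_two h6
    (A := ((⁅I, I⁆ : LieIdeal Φ L).toSubmodule ⊓ ℒ (-1)).map (Qm.of Φ L)) ?_ ?_ ?_ ?_ ?_
    _ ⟨y, ⟨hy, hy1⟩, rfl⟩
  · rintro _ ⟨x, ⟨-, hx⟩, rfl⟩ _ ⟨y, ⟨-, hy⟩, rfl⟩
    rw [← Qm.of_lie, h.lie_eq_zero hx hy (by norm_num), map_zero]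
  · rintro _ ⟨x, ⟨hx, hx1⟩, rfl⟩ _ ⟨y, ⟨-, hy1⟩, rfl⟩ _ ⟨z, ⟨hz, hz1⟩, rfl⟩
    obtain ⟨l, -, hl1, hl⟩ := hlie x hx hx1
    rw [hl, ← Qm.of_lie, ← Qm.of_lie]
    refine ⟨_, ⟨lie_mem_right Φ L _ _ _ hz, ?_⟩, rfl⟩
    simpa using SetLike.GradedBracket.bracket_mem (SetLike.GradedBracket.bracket_mem hl1 hy1) hz1
  · rintro _ ⟨x, ⟨hx, hx1⟩, rfl⟩ _ ⟨y, ⟨hy, hy1⟩, rfl⟩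
    obtain ⟨l, -, hl1, hl⟩ := hlie x hx hx1
    obtain ⟨m, -, hm1, hm⟩ := hlie y hy hy1
    rw [hl, hm, ← Qm.of_lie, h.lie_eq_zero hl1 hm1 (by norm_num), map_zero]
  · rintro _ ⟨x, ⟨hx, hx1⟩, rfl⟩
    obtain ⟨l, hlI, hl1, hl⟩ := hlie x hx hx1
    obtain ⟨m, hm3, hm, -⟩ := hq 1 l hlI hl1
    rw [hl, hm, h.eq_zero hm3 (by norm_num), map_zero]
  · rintro _ ⟨x, ⟨hx, hx1⟩, rfl⟩ hw
    obtain ⟨l, hlI, hl1, hl⟩ := hlie x hx hx1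
    rw [hl, h.eq_zero_of_lie_lie h3 hlI hl1 fun w hw' hw1 => ?_, map_zero]
    have hwl := hw _ ⟨w, ⟨hw', hw1⟩, rfl⟩
    rw [hl, ← Qm.of_lie, ← Qm.of_lie, ← map_zero (Qm.of Φ L)] at hwl
    rw [← lie_skew, Qm.of_injective hwl, neg_zero]

theorem eq_zero_of_mem_component_two [Semiprime Φ L] (h : IsNondegenerateThreeGrading ℒ)
    (h6 : IsUnit (6 : Φ)) {q : Qm Φ L} (hq : q ∈ Qm.component ℒ 2) : q = 0 := by
  obtain ⟨I, hI, gI, hqI⟩ := Qm.exists_lie_of_eq_of_mem_component hq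
  refine Qm.eq_zero_of_lie_homogeneous hI.lie_self (isHomogeneous_lie gI gI) fun i k hk hki => ?_
  by_cases hi : i = -1
  · exact h.lie_of_eq_zero_of_degree_two h6 hqI hk (hi ▸ hki)
  obtain ⟨l, hl2, hl, -⟩ := hqI i k (lie_self_le I hk) hki
  by_cases hi' : i < -1
  · rw [h.eq_zero hki (Or.inl hi'), map_zero, lie_zero]
  · rw [hl, h.eq_zero hl2 (by lia), map_zero]

theorem eq_zero_of_lie_of_eq_zero [Semiprime Φ L] (h : IsNondegenerateThreeGrading ℒ)
    (h3 : IsUnit (3 : Φ)) {K : LieIdeal Φ L} (hK : IsEssential K)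
    (gK : DirectSum.SetLike.IsHomogeneous ℒ K) {q : Qm Φ L} (hq : q ∈ Qm.component ℒ 1)
    (hqK : ∀ y ∈ K, y ∈ ℒ (-1) → ⁅q, Qm.of Φ L y⁆ = 0) : q = 0 := by
  obtain ⟨I, hI, gI, hqI⟩ := Qm.exists_lie_of_eq_of_mem_component hq
  refine Qm.eq_zero_of_lie_homogeneous (hK.inf hI) (isHomogeneous_inf gK gI) fun i k hk hki => ?_
  obtain ⟨l, hli, hl, -⟩ := hqI i k hk.2 hki
  by_cases hi : i = -1
  · exact hqK k hk.1 (hi ▸ hki)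
  by_cases hi0 : i = 0
  · subst hi0
    have hl0 : l = 0 := h.eq_zero_of_lie_ideal h3 hK gK (by simpa using hli) fun y hy hy1 => by
      have hky : ⁅k, y⁆ ∈ ℒ (-1) := by simpa using SetLike.GradedBracket.bracket_mem hki hy1
      refine Qm.of_injective (Φ := Φ) ?_
      rw [Qm.of_lie, ← hl, lie_lie, ← Qm.of_lie, hqK y hy hy1,
        hqK _ (lie_mem_right Φ L K k y hy) hky, lie_zero, sub_zero, map_zero]
    rw [hl, hl0, map_zero]
  · by_cases hi' : i < -1
    · rw [h.eq_zero hki (Or.inl hi'), map_zero, lie_zero]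
    · rw [hl, h.eq_zero hli (by lia), map_zero]

end IsNondegenerateThreeGrading

end ThreeGraded

end LieQuot

/-! ### The Tits–Kantor–Koecher algebra -/

namespace JordanPair.TKK

variable {Φ Vp Vm : Type*} [CommRing Φ] [AddCommGroup Vp] [Module Φ Vp]
  [AddCommGroup Vm] [Module Φ Vm] [JordanPair Φ Vp Vm]

-- Without this shortcut the instance takes seconds to be found.
instance : Zero (IDer Φ Vp Vm) := inferInstance

@[simp] theorem inner_zero_left (y : Vm) : inner Φ (0 : Vp) y = 0 := by
  rw [← sub_self (0 : Vp), inner_sub_left, sub_self]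

@[simp] theorem inner_zero_right (x : Vp) : inner Φ x (0 : Vm) = 0 := by
  rw [← sub_self (0 : Vm), inner_sub_right, sub_self]

theorem mk_pos_add_mk_der_add_mk_neg (a : TKK Φ Vp Vm) :
    mk a.pos 0 0 + mk 0 a.der 0 + mk 0 0 a.neg = a :=
  ext (by simp) (by simp) (by simp)

theorem mk_der_add (γ μ : IDer Φ Vp Vm) : mk 0 (γ + μ) 0 = mk 0 γ 0 + mk 0 μ 0 :=
  ext (add_zero _).symm rfl (add_zero _).symm

theorem mk_der_smul (c : Φ) (γ : IDer Φ Vp Vm) : mk 0 (c • γ) 0 = c • mk 0 γ 0 :=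
  ext (smul_zero c).symm rfl (smul_zero c).symm

theorem lie_pos_neg (x : Vp) (y : Vm) :
    ⁅(mk x 0 0 : TKK Φ Vp Vm), (mk 0 0 y : TKK Φ Vp Vm)⁆ = mk 0 (inner Φ x y) 0 :=
  ext (by simp [pos_lie]) (by simp [der_lie]) (by simp [neg_lie])

theorem lie_neg_pos (y : Vm) (x : Vp) :
    ⁅(mk 0 0 y : TKK Φ Vp Vm), (mk x 0 0 : TKK Φ Vp Vm)⁆ = mk 0 (-inner Φ x y) 0 :=
  ext (by simp [pos_lie]) (by simp [der_lie]) (by simp [neg_lie])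

theorem lie_der_pos (γ : IDer Φ Vp Vm) (x : Vp) :
    ⁅(mk 0 γ 0 : TKK Φ Vp Vm), (mk x 0 0 : TKK Φ Vp Vm)⁆ = mk (γ.1.1 x) 0 0 :=
  ext (by simp [pos_lie]) (by simp [der_lie]) (by simp [neg_lie])

theorem lie_lie_pos_neg (x : Vp) (y : Vm) :
    ⁅(mk x 0 0 : TKK Φ Vp Vm), ⁅(mk x 0 0 : TKK Φ Vp Vm), (mk 0 0 y : TKK Φ Vp Vm)⁆⁆ =
      mk (-tp (Φ := Φ) x y x) 0 0 := by
  rw [lie_pos_neg]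
  exact ext (by simp [pos_lie, inner_fst]) (by simp [der_lie]) (by simp [neg_lie])

@[elab_as_elim]
theorem ider_induction {p : IDer Φ Vp Vm → Prop} (inner : ∀ x y, p (inner Φ x y))
    (add : ∀ γ μ, p γ → p μ → p (γ + μ)) (smul : ∀ (c : Φ) γ, p γ → p (c • γ))
    (γ : IDer Φ Vp Vm) : p γ := by
  obtain ⟨γ, hγ⟩ := γ
  induction hγ using Submodule.span_induction with
  | mem γ h =>
    obtain ⟨x, y, rfl⟩ := h
    exact inner x y
  | zero =>
    have h := inner 0 0
    rwa [inner_zero_left] at h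
  | add γ μ hγ hμ ihγ ihμ => exact add ⟨γ, hγ⟩ ⟨μ, hμ⟩ ihγ ihμ
  | smul c γ hγ ih => exact smul c ⟨γ, hγ⟩ ih

theorem eq_top_of_forall_mem {S : LieSubalgebra Φ (TKK Φ Vp Vm)} (hp : ∀ x, mk x 0 0 ∈ S)
    (hn : ∀ y, mk 0 0 y ∈ S) : S = ⊤ := by
  refine eq_top_iff.mpr fun a _ => ?_
  have hd (γ : IDer Φ Vp Vm) : mk 0 γ 0 ∈ S := by
    induction γ using ider_induction with
    | inner x y => exact lie_pos_neg (Φ := Φ) x y ▸ S.lie_mem (hp x) (hn y)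
    | add γ μ hγ hμ => exact mk_der_add γ μ ▸ add_mem hγ hμ
    | smul c γ hγ => exact mk_der_smul c γ ▸ S.smul_mem c hγ
  exact mk_pos_add_mk_der_add_mk_neg a ▸ add_mem (add_mem (hp _) (hd _)) (hn _)

theorem coe_decompose (a : TKK Φ Vp Vm) (n : ℤ) :
    (DirectSum.decompose (grading Φ Vp Vm) a n : TKK Φ Vp Vm) =
      mk (if n = 1 then a.pos else 0) (if n = 0 then a.der else 0)
        (if n = -1 then a.neg else 0) := by
  change ((decomp a n : grading Φ Vp Vm n) : TKK Φ Vp Vm) = _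
  simp only [decomp, DirectSum.add_apply, Submodule.coe_add, DirectSum.coe_of_apply]
  simp only [eq_comm (a := n)]
  split_ifs <;> first | lia | simp [homPos, homDer, homNeg]
  all_goals rfl

theorem isHomogeneous_iff {K : LieIdeal Φ (TKK Φ Vp Vm)} :
    DirectSum.SetLike.IsHomogeneous (grading Φ Vp Vm) K ↔
      ∀ a ∈ K, mk a.pos 0 0 ∈ K ∧ mk 0 a.der 0 ∈ K ∧ mk 0 0 a.neg ∈ K := by
  refine ⟨fun h a ha => ⟨?_, ?_, ?_⟩, fun h n a ha => ?_⟩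
  · simpa [coe_decompose] using h 1 ha
  · simpa [coe_decompose] using h 0 ha
  · simpa [coe_decompose] using h (-1) ha
  · obtain ⟨hp, hd, hn⟩ := h a ha
    change (DirectSum.decompose (grading Φ Vp Vm) a n : TKK Φ Vp Vm) ∈ K
    rw [coe_decompose]
    split_ifs <;> first | lia | assumption | exact zero_mem K

theorem isNondegenerateThreeGrading [StronglyNondegenerate Φ Vp Vm] :
    LieQuot.IsNondegenerateThreeGrading (grading Φ Vp Vm) where
  eq_zero ha hn := ext (ha.1 (by lia)) (ha.2.1 (by lia)) (ha.2.2 (by lia))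
  nondegenerate {a} ha h := by
    have ha' : a = mk a.pos 0 0 := ext rfl (ha.2.1 (by norm_num)) (ha.2.2 (by norm_num))
    have hpos : a.pos = 0 := StronglyNondegenerate.eq_zero_of_tp (Φ := Φ) (Vm := Vm) _ fun y => by
      have hy := h (mk 0 0 y) ⟨fun _ => rfl, fun _ => rfl, fun h => absurd rfl h⟩
      rw [ha', lie_lie_pos_neg] at hy
      exact neg_eq_zero.mp (congrArg pos hy)
    rw [ha', hpos]
    rfl

end JordanPair.TKK

namespace JordanTripleSystem

open JordanPair LieQuot

/-! ### The Jordan triple system `Q_m(TKK(V(T)))₁` -/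

section OfInvolution

variable {Φ L : Type*} [CommRing Φ] [LieRing L] [LieAlgebra Φ L] {τ : L →ₗ⁅Φ⁆ L}
  {M : Submodule Φ L}

/-- The product `{p, q, r} = [[p, τ q], r]` on a submodule `M` closed under it. -/
def involutionTriple (hM : ∀ p ∈ M, ∀ q ∈ M, ∀ r ∈ M, ⁅⁅p, τ q⁆, r⁆ ∈ M) :
    M →ₗ[Φ] M →ₗ[Φ] M →ₗ[Φ] M :=
  LinearMap.mk₂ Φ (fun p q =>
    { toFun := fun r => ⟨⁅⁅(p : L), τ q⁆, (r : L)⁆, hM p p.2 q q.2 r r.2⟩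
      map_add' := fun _ _ => Subtype.ext (lie_add _ _ _)
      map_smul' := fun _ _ => Subtype.ext (lie_smul _ _ _) })
    (fun p p' q => LinearMap.ext fun r => Subtype.ext (by simp))
    (fun c p q => LinearMap.ext fun r => Subtype.ext (by simp))
    (fun p q q' => LinearMap.ext fun r => Subtype.ext (by simp))
    (fun c p q => LinearMap.ext fun r => Subtype.ext (by simp))

/-- The Jordan triple system on an abelian submodule `M` of a Lie algebra with involution `τ`, with
product `{p, q, r} = [[p, τ q], r]`. -/
abbrev ofInvolution (hτ : ∀ p, τ (τ p) = p) (hab : ∀ p ∈ M, ∀ q ∈ M, ⁅p, q⁆ = 0)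
    (hM : ∀ p ∈ M, ∀ q ∈ M, ∀ r ∈ M, ⁅⁅p, τ q⁆, r⁆ ∈ M) : JordanTripleSystem Φ M where
  triple := involutionTriple hM
  triple_comm p q r := Subtype.ext <| by
    change ⁅⁅(p : L), τ q⁆, (r : L)⁆ = ⁅⁅(r : L), τ q⁆, (p : L)⁆
    rw [lie_lie, hab p p.2 r r.2, lie_zero, sub_zero, ← lie_skew, ← lie_skew (r : L), neg_lie]
  triple_jordan x y u v z := Subtype.ext <| by
    change ⁅⁅(x : L), τ y⁆, ⁅⁅(u : L), τ v⁆, (z : L)⁆⁆ =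
      ⁅⁅⁅⁅(x : L), τ y⁆, (u : L)⁆, τ v⁆, (z : L)⁆ -
        ⁅⁅(u : L), τ ⁅⁅(y : L), τ x⁆, (v : L)⁆⁆, (z : L)⁆ +
        ⁅⁅(u : L), τ v⁆, ⁅⁅(x : L), τ y⁆, (z : L)⁆⁆
    have hv : τ ⁅⁅(y : L), τ x⁆, (v : L)⁆ = -⁅⁅(x : L), τ y⁆, τ v⁆ := by
      rw [LieHom.map_lie, LieHom.map_lie, hτ, ← lie_skew (x : L), neg_lie, neg_neg]
    rw [hv, lie_neg, neg_lie, sub_neg_eq_add, leibniz_lie, leibniz_lie _ (u : L), add_lie]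

end OfInvolution

section QmOne

variable {Φ T : Type*} [CommRing Φ] [AddCommGroup T] [Module Φ T] [JordanTripleSystem Φ T]

theorem exchange_exchange (a : TKK Φ T T) : exchange Φ T (exchange Φ T a) = a := rfl

theorem exchange_mem_grading_iff (n : ℤ) (a : TKK Φ T T) :
    exchange Φ T a ∈ TKK.grading Φ T T n ↔ a ∈ TKK.grading Φ T T (-n) := by
  have hder : swapDer a.der = 0 ↔ a.der = 0 :=
    ⟨fun h => congrArg swapDer h, fun h => (congrArg swapDer h).trans rfl⟩
  change (_ → a.neg = 0) ∧ (_ → swapDer a.der = 0) ∧ (_ → a.pos = 0) ↔ _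
  rw [hder, TKK.mem_grading]
  grind

variable [StronglyNondegenerate Φ T]

noncomputable instance [h6 : Fact (IsUnit (6 : Φ))] : JordanTripleSystem Φ (QmOne Φ T) :=
  ofInvolution (τ := Qm.conjHom (exchange Φ T)) (Qm.conj_conj exchange_exchange)
    (fun _ hp _ hq =>
      TKK.isNondegenerateThreeGrading.eq_zero_of_mem_component_two h6.out
        (Qm.lie_mem_component hp hq))
    (fun _ hp _ hq _ hr => by
      have h := Qm.lie_mem_component (Qm.lie_mem_component hp
        (Qm.conj_mem_component exchange_mem_grading_iff hq)) hr
      rwa [add_neg_cancel, zero_add] at h)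

theorem coe_triple_qmOne [Fact (IsUnit (6 : Φ))] (p q r : QmOne Φ T) :
    (triple (Φ := Φ) p q r : Qm Φ (TKK Φ T T)) =
      ⁅⁅(p : Qm Φ (TKK Φ T T)), Qm.conj (exchange Φ T) q⁆, (r : Qm Φ (TKK Φ T T))⁆ := rfl

end QmOne

section QuotientsOfQmOne

variable {Φ T : Type*} [CommRing Φ] [AddCommGroup T] [Module Φ T] [JordanTripleSystem Φ T]

theorem lie_lie_mk (x y z : T) :
    ⁅⁅(TKK.mk x 0 0 : TKK Φ T T), (TKK.mk 0 0 y : TKK Φ T T)⁆, (TKK.mk z 0 0 : TKK Φ T T)⁆ =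
      TKK.mk (triple (Φ := Φ) x y z) 0 0 := by
  rw [TKK.lie_pos_neg, TKK.lie_der_pos]
  rfl

theorem isIdeal_comap_toTKK {K : LieIdeal Φ (TKK Φ T T)} (hK : ∀ a ∈ K, exchange Φ T a ∈ K) :
    IsIdeal (K.toSubmodule.comap (toTKK Φ T)) := fun a (ha : TKK.mk a 0 0 ∈ K) x y => by
  change TKK.mk _ 0 0 ∈ K ∧ TKK.mk _ 0 0 ∈ K ∧ TKK.mk _ 0 0 ∈ K
  rw [← lie_lie_mk, ← lie_lie_mk, ← lie_lie_mk]
  exact ⟨lie_mem_left Φ _ K _ _ (lie_mem_left Φ _ K _ _ ha),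
    lie_mem_left Φ _ K _ _ (lie_mem_right Φ _ K _ _ (hK _ ha)), lie_mem_right Φ _ K _ _ ha⟩

theorem inner_eq_zero {x y : T} (hxy : ∀ z, triple (Φ := Φ) x y z = 0)
    (hyx : ∀ z, triple (Φ := Φ) y x z = 0) : JordanPair.inner Φ x y = 0 :=
  Subtype.ext (Prod.ext (LinearMap.ext hxy) (LinearMap.ext fun z => neg_eq_zero.mpr (hyx z)))

theorem eq_mk_neg_of_mem_grading {a : TKK Φ T T} (ha : a ∈ TKK.grading Φ T T (-1)) :
    a = TKK.mk 0 0 a.neg := TKK.ext (ha.1 (by norm_num)) (ha.2.1 (by norm_num)) rfl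

theorem eq_mk_der_of_mem_grading {a : TKK Φ T T} (ha : a ∈ TKK.grading Φ T T 0) :
    a = TKK.mk 0 a.der 0 := TKK.ext (ha.1 (by norm_num)) rfl (ha.2.2 (by norm_num))

theorem eq_mk_pos_of_mem_grading {a : TKK Φ T T} (ha : a ∈ TKK.grading Φ T T 1) :
    a = TKK.mk a.pos 0 0 := TKK.ext rfl (ha.2.1 (by norm_num)) (ha.2.2 (by norm_num))

theorem coe_toQmOne (x : T) :
    (toQmOne Φ T x : Qm Φ (TKK Φ T T)) = Qm.of Φ (TKK Φ T T) (TKK.mk x 0 0) := rfl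

theorem conj_toQmOne (x : T) : Qm.conj (exchange Φ T) (toQmOne Φ T x) =
    Qm.of Φ (TKK Φ T T) (TKK.mk 0 0 x) := Qm.conj_of _ _

variable [StronglyNondegenerate Φ T]

theorem toQmOne_injective : Function.Injective (toQmOne Φ T) := fun x y h => by
  have hxy : Qm.of Φ (TKK Φ T T) (TKK.mk x 0 0) = Qm.of Φ (TKK Φ T T) (TKK.mk y 0 0) :=
    congrArg Subtype.val h
  exact congrArg TKK.pos (Qm.of_injective (Φ := Φ) hxy)

theorem annEqZero_comap_toTKK (h3 : IsUnit (3 : Φ)) {K : LieIdeal Φ (TKK Φ T T)}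
    (hK : IsEssential K) (gK : DirectSum.SetLike.IsHomogeneous (TKK.grading Φ T T) K)
    (sK : ∀ a ∈ K, exchange Φ T a ∈ K) : AnnEqZero (K.toSubmodule.comap (toTKK Φ T)) := by
  refine fun z hz => congrArg TKK.pos (TKK.isNondegenerateThreeGrading.eq_zero_of_lie_ideal h3 hK gK
    (TKK.homPos (TKK.mk z 0 0)).2 fun y hy hy1 => ?_)
  rw [eq_mk_neg_of_mem_grading hy1] at hy ⊢
  have hzy := hz y.neg (sK _ hy)
  change ⁅(TKK.mk z 0 0 : TKK Φ T T), (TKK.mk 0 0 y.neg : TKK Φ T T)⁆ = 0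
  rw [TKK.lie_pos_neg, inner_eq_zero (fun w => (hzy w).1)
    fun w => (triple_comm _ _ _).trans (hzy w).2.2]
  rfl

theorem exists_absorbing_ideal {q : Qm Φ (TKK Φ T T)} (hq : q ∈ QmOne Φ T) :
    ∃ K : LieIdeal Φ (TKK Φ T T), IsEssential K ∧
      DirectSum.SetLike.IsHomogeneous (TKK.grading Φ T T) K ∧ (∀ a ∈ K, exchange Φ T a ∈ K) ∧
      (∀ y, TKK.mk 0 0 y ∈ K → ∃ γ, ⁅q, Qm.of Φ (TKK Φ T T) (TKK.mk 0 0 y)⁆ =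
        Qm.of Φ (TKK Φ T T) (TKK.mk 0 γ 0)) ∧
      ∀ γ, TKK.mk 0 γ 0 ∈ K → ∃ x, ⁅q, Qm.of Φ (TKK Φ T T) (TKK.mk 0 γ 0)⁆ =
        Qm.of Φ (TKK Φ T T) (TKK.mk x 0 0) := by
  obtain ⟨I, hI, gI, hqI⟩ := Qm.exists_lie_of_eq_of_mem_component hq
  have gI' : DirectSum.SetLike.IsHomogeneous (TKK.grading Φ T T)
      (I.comap ((exchange Φ T).symm : TKK Φ T T →ₗ⁅Φ⁆ TKK Φ T T)) := by
    rw [TKK.isHomogeneous_iff] at gI ⊢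
    intro a ha
    obtain ⟨hp, hd, hn⟩ := gI (exchange Φ T a) ha
    exact ⟨hn, hd, hp⟩
  refine ⟨_, hI.inf (hI.comap (exchange Φ T)), isHomogeneous_inf gI gI',
    fun a ha => ?_, fun y hy => ?_, fun γ hγ => ?_⟩
  · obtain ⟨h, h'⟩ := (LieSubmodule.mem_inf _ _ _).mp ha
    exact (LieSubmodule.mem_inf _ _ _).mpr ⟨h', h⟩
  · obtain ⟨l, hl, hql, -⟩ :=
      hqI (-1) _ ((LieSubmodule.mem_inf _ _ _).mp hy).1 (TKK.homNeg (TKK.mk 0 0 y)).2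
    exact ⟨l.der, hql.trans (congrArg _ (eq_mk_der_of_mem_grading hl))⟩
  · obtain ⟨l, hl, hql, -⟩ :=
      hqI 0 _ ((LieSubmodule.mem_inf _ _ _).mp hγ).1 (TKK.homDer (TKK.mk 0 γ 0)).2
    exact ⟨l.pos, hql.trans (congrArg _ (eq_mk_pos_of_mem_grading hl))⟩

section Triple

variable [Fact (IsUnit (6 : Φ))]

theorem triple_toQmOne_left {q : QmOne Φ T} {a : T} {γ : IDer Φ T T}
    (hγ : ⁅(q : Qm Φ (TKK Φ T T)), Qm.of Φ (TKK Φ T T) (TKK.mk 0 0 a)⁆ =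
      Qm.of Φ (TKK Φ T T) (TKK.mk 0 γ 0)) (x : T) :
    triple (Φ := Φ) q (toQmOne Φ T a) (toQmOne Φ T x) = toQmOne Φ T (γ.1.1 x) := Subtype.ext <| by
  rw [coe_triple_qmOne, conj_toQmOne, hγ, coe_toQmOne, coe_toQmOne, ← Qm.of_lie, TKK.lie_der_pos]

theorem triple_toQmOne_middle {q : QmOne Φ T} {a : T} {γ : IDer Φ T T}
    (hγ : ⁅(q : Qm Φ (TKK Φ T T)), Qm.of Φ (TKK Φ T T) (TKK.mk 0 0 a)⁆ =
      Qm.of Φ (TKK Φ T T) (TKK.mk 0 γ 0)) (x : T) :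
    triple (Φ := Φ) (toQmOne Φ T a) q (toQmOne Φ T x) = -toQmOne Φ T (γ.1.2 x) := by
  have h : ⁅(toQmOne Φ T a : Qm Φ (TKK Φ T T)), Qm.conj (exchange Φ T) q⁆ =
      -Qm.of Φ (TKK Φ T T) (TKK.mk 0 (swapDer γ) 0) := by
    rw [← Qm.conj_conj exchange_exchange (toQmOne Φ T a : Qm Φ (TKK Φ T T)), ← Qm.conj_lie,
      conj_toQmOne, ← lie_skew, hγ, ← map_neg, Qm.conj_of, ← map_neg]
    exact congrArg _ (map_neg (exchange Φ T) _)
  refine Subtype.ext ?_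
  rw [coe_triple_qmOne, h, coe_toQmOne, neg_lie, ← Qm.of_lie, TKK.lie_der_pos]
  rfl

theorem triple_toQmOne_right {q : QmOne Φ T} {a x z : T}
    (hz : ⁅(q : Qm Φ (TKK Φ T T)), Qm.of Φ (TKK Φ T T) (TKK.mk 0 (-JordanPair.inner Φ a x) 0)⁆ =
      Qm.of Φ (TKK Φ T T) (TKK.mk z 0 0)) :
    triple (Φ := Φ) q (toQmOne Φ T x) (toQmOne Φ T a) = toQmOne Φ T z := Subtype.ext <| by
  have hqa : ⁅(q : Qm Φ (TKK Φ T T)), (toQmOne Φ T a : Qm Φ (TKK Φ T T))⁆ = 0 :=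
    TKK.isNondegenerateThreeGrading.eq_zero_of_mem_component_two Fact.out
      (Qm.lie_mem_component q.2 (toQmOne Φ T a).2)
  rw [coe_triple_qmOne, conj_toQmOne, lie_lie, hqa, lie_zero, sub_zero, coe_toQmOne, coe_toQmOne,
    ← hz, ← Qm.of_lie, TKK.lie_neg_pos]

theorem isMQuotients_toQmOne : IsMQuotients (toQmOne Φ T) := by
  have h6 : IsUnit (6 : Φ) := Fact.out
  have h3 : IsUnit (3 : Φ) := isUnit_of_mul_isUnit_left (y := 2) (by norm_num [h6])
  refine ⟨toQmOne_injective, fun x y z => Subtype.ext ?_, fun q hq => ?_⟩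
  · rw [coe_triple_qmOne, conj_toQmOne, coe_toQmOne, coe_toQmOne, coe_toQmOne, ← Qm.of_lie,
      ← Qm.of_lie, lie_lie_mk]
  obtain ⟨K, hK, gK, sK, hneg, hder⟩ := exists_absorbing_ideal q.2
  refine ⟨_, isIdeal_comap_toTKK sK, annEqZero_comap_toTKK h3 hK gK sK,
    fun a (ha : TKK.mk a 0 0 ∈ K) x => ?_, ?_⟩
  · obtain ⟨γ, hγ⟩ := hneg a (sK _ ha)
    have hax : TKK.mk 0 (-JordanPair.inner Φ a x) 0 ∈ K := by
      rw [← TKK.lie_neg_pos]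
      exact lie_mem_right Φ _ K _ _ ha
    obtain ⟨z, hz⟩ := hder _ hax
    exact ⟨⟨_, (triple_toQmOne_left hγ x).symm⟩, ⟨_, (triple_toQmOne_right hz).symm⟩,
      -γ.1.2 x, (map_neg _ _).trans (triple_toQmOne_middle hγ x).symm⟩
  · by_contra! hzero
    refine hq (Subtype.ext (TKK.isNondegenerateThreeGrading.eq_zero_of_lie_of_eq_zero h3 hK gK q.2
      fun y hy hy1 => ?_))
    rw [eq_mk_neg_of_mem_grading hy1] at hy ⊢
    obtain ⟨γ, hγ⟩ := hneg _ hy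
    have hqy := hzero y.neg (sK _ hy)
    have hγ0 : γ = 0 := by
      refine Subtype.ext (Prod.ext (LinearMap.ext fun x => ?_) (LinearMap.ext fun x => ?_))
      · refine (map_eq_zero_iff _ (toQmOne_injective (Φ := Φ))).mp ?_
        rw [← triple_toQmOne_left hγ x, (hqy x).1]
      · refine (map_eq_zero_iff _ (toQmOne_injective (Φ := Φ))).mp (neg_eq_zero.mp ?_)
        rw [← triple_toQmOne_middle hγ x, (hqy x).2.2]
    rw [hγ, hγ0]
    exact map_zero _

end Triple

end QuotientsOfQmOne

/-! ### Jordan triple systems of `𝔐`-quotients -/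

section Quotients

variable {Φ T W : Type*} [CommRing Φ] [AddCommGroup T] [Module Φ T]
  [AddCommGroup W] [Module Φ W] [JordanTripleSystem Φ W] {j : T →ₗ[Φ] W} {I : Submodule Φ T}

/-- The condition `{w, I, T} = {w, T, I} = {I, w, T} = 0` on an element `w` of a Jordan triple
system `W` into which `T` is mapped by `j`. For `j = id` it defines the annihilator of `I`. -/
def IsAnnihilatedBy (j : T →ₗ[Φ] W) (I : Submodule Φ T) (w : W) : Prop :=
  ∀ b ∈ I, ∀ y, triple (Φ := Φ) w (j b) (j y) = 0 ∧ triple (Φ := Φ) w (j y) (j b) = 0 ∧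
    triple (Φ := Φ) (j b) w (j y) = 0

namespace IsAnnihilatedBy

theorem symm {w : W} (hw : IsAnnihilatedBy j I w) {b : T} (hb : b ∈ I) (y : T) :
    triple (Φ := Φ) (j y) (j b) w = 0 ∧ triple (Φ := Φ) (j b) (j y) w = 0 ∧
      triple (Φ := Φ) (j y) w (j b) = 0 := by
  obtain ⟨h₁, h₂, h₃⟩ := hw b hb y
  exact ⟨(triple_comm _ _ _).trans h₁, (triple_comm _ _ _).trans h₂, (triple_comm _ _ _).trans h₃⟩

variable [JordanTripleSystem Φ T]

theorem eq_zero_of_map (hj : IsTripleHom j) (hinj : Function.Injective j) (hA : AnnEqZero I) {t : T}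
    (ht : IsAnnihilatedBy j I (j t)) : t = 0 := by
  refine hA t fun b hb y => ?_
  obtain ⟨h₁, h₂, h₃⟩ := ht b hb y
  rw [triple_comm] at h₃
  refine ⟨hinj ?_, hinj ?_, hinj ?_⟩ <;> rwa [hj, map_zero]

variable {w : W} (hj : IsTripleHom j) (hI : IsIdeal I) (hw : IsAnnihilatedBy j I w)
include hj hI hw

theorem triple_left (s x : T) : IsAnnihilatedBy j I (triple (Φ := Φ) w (j s) (j x)) := by
  intro b hb y
  refine ⟨?_, ?_, ?_⟩
  · rw [triple_comm, triple_jordan, (hw.symm hb y).1, ← hj, ← hj, (hw _ (hI b hb y s).1 x).1,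
      (hw _ (hI b hb y x).2.1 s).2.1]
    simp
  · rw [triple_comm, triple_jordan, (hw.symm hb y).2.1, ← hj, ← hj, (hw _ (hI b hb y s).2.1 x).1,
      (hw _ (hI b hb y x).1 s).2.1]
    simp
  · have h := triple_jordan (Φ := Φ) (j s) w (j b) (j x) (j y)
    have h' := triple_jordan (Φ := Φ) (j b) (j x) (j s) w (j y)
    rw [(hw.symm hb x).1, ← hj, ← hj, (hw _ (hI b hb x s).1 y).2.2,
      (hw.symm (hI b hb x y).1 s).2.2] at h'
    rw [h', (hw.symm hb s).2.2, ← hj, (hw.symm (hI b hb x y).1 s).2.2] at h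
    simpa using h

theorem triple_middle (s x : T) : IsAnnihilatedBy j I (triple (Φ := Φ) (j s) w (j x)) := by
  intro b hb y
  refine ⟨?_, ?_, ?_⟩
  · rw [triple_comm, triple_jordan, (hw.symm hb y).2.1, ← hj, ← hj, (hw _ (hI b hb y s).2.1 x).2.2,
      (hw.symm (hI b hb y x).2.1 s).2.2]
    simp
  · rw [triple_comm, triple_jordan, (hw.symm hb y).1, ← hj, ← hj, (hw _ (hI b hb y s).1 x).2.2,
      (hw.symm (hI b hb y x).1 s).2.2]
    simp
  · have h := triple_jordan (Φ := Φ) w (j s) (j b) (j x) (j y)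
    have h' := triple_jordan (Φ := Φ) (j b) (j x) w (j s) (j y)
    rw [(hw.symm hb x).2.1, ← hj, ← hj, (hw _ (hI b hb x s).2.1 y).1,
      (hw _ (hI b hb x y).1 s).2.1] at h'
    rw [h', (hw b hb s).2.1, ← hj, (hw _ (hI b hb x y).1 s).2.1] at h
    simpa using h

end IsAnnihilatedBy

variable [JordanTripleSystem Φ T]

theorem IsMQuotients.eq_zero_of_isAnnihilatedBy (hj : IsMQuotients j) (hI : IsIdeal I)
    (hA : AnnEqZero I) {w : W} (hw : IsAnnihilatedBy j I w) : w = 0 := by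
  obtain ⟨hinj, hhom, hq⟩ := hj
  have eq_zero {v : W} (hv : IsAnnihilatedBy j I v) (hmem : v ∈ LinearMap.range j) : v = 0 := by
    obtain ⟨t, rfl⟩ := hmem
    rw [hv.eq_zero_of_map hhom hinj hA, map_zero]
  by_contra hw0
  obtain ⟨I', -, -, habs, a, ha, x, hne⟩ := hq w hw0
  obtain ⟨h₁, h₂, h₃⟩ := habs a ha x
  rcases hne with hne | hne | hne
  · exact hne (eq_zero (hw.triple_left hhom hI a x) h₁)
  · exact hne (eq_zero (hw.triple_left hhom hI x a) h₂)
  · exact hne (eq_zero (hw.triple_middle hhom hI a x) h₃)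

theorem IsMQuotients.ider_fst_eq_zero (hj : IsMQuotients j) {γ : IDer Φ W W}
    (h₁ : ∀ x, γ.1.1 (j x) = 0) (h₂ : ∀ x, γ.1.2 (j x) = 0) (w : W) : γ.1.1 w = 0 := by
  have hd₁ (x y z : W) : γ.1.1 (triple (Φ := Φ) x y z) = triple (Φ := Φ) (γ.1.1 x) y z +
      triple (Φ := Φ) x (γ.1.2 y) z + triple (Φ := Φ) x y (γ.1.1 z) :=
    (isDerivation_of_mem Φ W W γ.2).1 x y z
  have hd₂ (x y z : W) : γ.1.2 (triple (Φ := Φ) x y z) = triple (Φ := Φ) (γ.1.2 x) y z +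
      triple (Φ := Φ) x (γ.1.1 y) z + triple (Φ := Φ) x y (γ.1.2 z) :=
    (isDerivation_of_mem Φ W W γ.2).2 x y z
  rcases eq_or_ne w 0 with rfl | hw
  · exact map_zero _
  obtain ⟨I, hI, hA, habs, -⟩ := hj.2.2 w hw
  refine hj.eq_zero_of_isAnnihilatedBy hI hA fun b hb y => ?_
  obtain ⟨⟨t₁, ht₁⟩, ⟨t₂, ht₂⟩, ⟨t₃, ht₃⟩⟩ := habs b hb y
  refine ⟨?_, ?_, ?_⟩
  · have h := hd₁ w (j b) (j y)
    rw [← ht₁, h₁, h₂, h₁] at h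
    simpa using h.symm
  · have h := hd₁ w (j y) (j b)
    rw [← ht₂, h₁, h₂, h₁] at h
    simpa using h.symm
  · have h := hd₂ (j b) w (j y)
    rw [← ht₃, h₂, h₂, h₂] at h
    simpa using h.symm

theorem IsMQuotients.ider_ext (hj : IsMQuotients j) {γ μ : IDer Φ W W}
    (h₁ : ∀ x, γ.1.1 (j x) = μ.1.1 (j x)) (h₂ : ∀ x, γ.1.2 (j x) = μ.1.2 (j x)) : γ = μ := by
  have h₁' (x : T) : (γ - μ).1.1 (j x) = 0 := by rw [TKK.sub_fst, h₁, sub_self]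
  have h₂' (x : T) : (γ - μ).1.2 (j x) = 0 := by rw [TKK.sub_snd, h₂, sub_self]
  exact sub_eq_zero.mp <| Subtype.ext <| Prod.ext (LinearMap.ext (hj.ider_fst_eq_zero h₁' h₂'))
    (LinearMap.ext (hj.ider_fst_eq_zero (γ := swapDer (γ - μ)) h₂' h₁'))

end Quotients

section MapTKK

variable {Φ T W : Type*} [CommRing Φ] [AddCommGroup T] [Module Φ T] [JordanTripleSystem Φ T]
  [AddCommGroup W] [Module Φ W] [JordanTripleSystem Φ W] {j : T →ₗ[Φ] W}

theorem IsTripleHom.exists_ider (hj : IsTripleHom j) (γ : IDer Φ T T) :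
    ∃ μ : IDer Φ W W, (∀ x, μ.1.1 (j x) = j (γ.1.1 x)) ∧ ∀ x, μ.1.2 (j x) = j (γ.1.2 x) := by
  induction γ using TKK.ider_induction with
  | inner x y =>
    refine ⟨JordanPair.inner Φ (j x) (j y), fun z => (hj x y z).symm, fun z => ?_⟩
    rw [TKK.inner_snd, TKK.inner_snd, map_neg]
    exact congrArg Neg.neg (hj y x z).symm
  | add γ γ' hγ hγ' =>
    obtain ⟨μ, h₁, h₂⟩ := hγ
    obtain ⟨μ', h₁', h₂'⟩ := hγ'
    exact ⟨μ + μ', fun x => by rw [TKK.add_fst, TKK.add_fst, h₁, h₁', map_add],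
      fun x => by rw [TKK.add_snd, TKK.add_snd, h₂, h₂', map_add]⟩
  | smul c γ hγ =>
    obtain ⟨μ, h₁, h₂⟩ := hγ
    exact ⟨c • μ, fun x => (congrArg (c • ·) (h₁ x)).trans (map_smul j c _).symm,
      fun x => (congrArg (c • ·) (h₂ x)).trans (map_smul j c _).symm⟩

variable (hj : IsMQuotients j)

/-- The unique extension of an inner derivation of `V(T)` to an inner derivation of `V(W)`, for a
Jordan triple system `W` of `𝔐`-quotients of `T`. -/
noncomputable def extDer (γ : IDer Φ T T) : IDer Φ W W := (hj.2.1.exists_ider γ).choose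

theorem extDer_fst (γ : IDer Φ T T) (x : T) : (extDer hj γ).1.1 (j x) = j (γ.1.1 x) :=
  (hj.2.1.exists_ider γ).choose_spec.1 x

theorem extDer_snd (γ : IDer Φ T T) (x : T) : (extDer hj γ).1.2 (j x) = j (γ.1.2 x) :=
  (hj.2.1.exists_ider γ).choose_spec.2 x

theorem extDer_inner (x y : T) :
    extDer hj (JordanPair.inner Φ x y) = JordanPair.inner Φ (j x) (j y) := by
  refine hj.ider_ext (fun z => ?_) fun z => ?_
  · rw [extDer_fst]
    exact hj.2.1 x y z
  · rw [extDer_snd, TKK.inner_snd, TKK.inner_snd, map_neg]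
    exact congrArg Neg.neg (hj.2.1 y x z)

theorem extDer_swapDer (γ : IDer Φ T T) : extDer hj (swapDer γ) = swapDer (extDer hj γ) :=
  hj.ider_ext (fun x => (extDer_fst hj _ x).trans (extDer_snd hj γ x).symm)
    fun x => (extDer_snd hj _ x).trans (extDer_fst hj γ x).symm

/-- `extDer` as a homomorphism of Lie algebras. -/
noncomputable def extDerHom : IDer Φ T T →ₗ⁅Φ⁆ IDer Φ W W where
  toFun := extDer hj
  map_add' γ μ := hj.ider_ext
    (fun x => by simp only [TKK.add_fst, extDer_fst, map_add])
    fun x => by simp only [TKK.add_snd, extDer_snd, map_add]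
  map_smul' c γ := hj.ider_ext
    (fun x => (extDer_fst hj _ x).trans
      ((map_smul j c _).trans (congrArg (c • ·) (extDer_fst hj γ x).symm)))
    fun x => (extDer_snd hj _ x).trans
      ((map_smul j c _).trans (congrArg (c • ·) (extDer_snd hj γ x).symm))
  map_lie' {γ μ} := hj.ider_ext
    (fun x => by simp only [TKK.lie_fst, extDer_fst, map_sub])
    fun x => by simp only [TKK.lie_snd, extDer_snd, map_sub]

theorem extDerHom_injective : Function.Injective (extDerHom hj) := by
  refine (injective_iff_map_eq_zero (extDerHom hj)).mpr fun γ (h : extDer hj γ = 0) => ?_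
  refine Subtype.ext (Prod.ext (LinearMap.ext fun x => hj.1 ?_) (LinearMap.ext fun x => hj.1 ?_))
  · rw [← extDer_fst hj, h]
    exact (map_zero j).symm
  · rw [← extDer_snd hj, h]
    exact (map_zero j).symm

/-- The homomorphism `TKK(V(T)) → TKK(V(W))` induced by the inclusion of `T` in a Jordan triple
system `W` of `𝔐`-quotients of `T`. -/
noncomputable def mapTKK : TKK Φ T T →ₗ⁅Φ⁆ TKK Φ W W where
  toFun a := TKK.mk (j a.pos) (extDerHom hj a.der) (j a.neg)
  map_add' a b := TKK.ext (map_add j _ _) (map_add (extDerHom hj) _ _) (map_add j _ _)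
  map_smul' c a := TKK.ext (map_smul j c _) (map_smul (extDerHom hj) c _) (map_smul j c _)
  map_lie' {a b} := by
    refine TKK.ext ?_ ?_ ?_
    · change j (a.der.1.1 b.pos - b.der.1.1 a.pos) =
        (extDer hj a.der).1.1 (j b.pos) - (extDer hj b.der).1.1 (j a.pos)
      rw [map_sub, extDer_fst, extDer_fst]
    · change extDerHom hj (⁅a.der, b.der⁆ + JordanPair.inner Φ a.pos b.neg -
        JordanPair.inner Φ b.pos a.neg) = ⁅extDerHom hj a.der, extDerHom hj b.der⁆ +
          JordanPair.inner Φ (j a.pos) (j b.neg) - JordanPair.inner Φ (j b.pos) (j a.neg)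
      rw [map_sub, map_add, LieHom.map_lie, ← extDer_inner hj, ← extDer_inner hj]
      rfl
    · change j (a.der.1.2 b.neg - b.der.1.2 a.neg) =
        (extDer hj a.der).1.2 (j b.neg) - (extDer hj b.der).1.2 (j a.neg)
      rw [map_sub, extDer_snd, extDer_snd]

theorem mapTKK_pos (x : T) : mapTKK hj (TKK.mk x 0 0) = TKK.mk (j x) 0 0 :=
  TKK.ext rfl (map_zero (extDerHom hj)) (map_zero j)

theorem mapTKK_neg (x : T) : mapTKK hj (TKK.mk 0 0 x) = TKK.mk 0 0 (j x) :=
  TKK.ext (map_zero j) (map_zero (extDerHom hj)) rfl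

theorem mapTKK_exchange (a : TKK Φ T T) :
    mapTKK hj (exchange Φ T a) = exchange Φ W (mapTKK hj a) :=
  TKK.ext rfl (extDer_swapDer hj a.der) rfl

theorem mapTKK_mem_grading {n : ℤ} {a : TKK Φ T T} :
    mapTKK hj a ∈ TKK.grading Φ W W n ↔ a ∈ TKK.grading Φ T T n := by
  change (_ → j a.pos = 0) ∧ (_ → extDerHom hj a.der = 0) ∧ (_ → j a.neg = 0) ↔ _
  rw [map_eq_zero_iff j hj.1, map_eq_zero_iff j hj.1,
    map_eq_zero_iff (extDerHom hj) (extDerHom_injective hj)]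
  rfl

theorem mapTKK_injective : Function.Injective (mapTKK hj) := by
  refine (injective_iff_map_eq_zero (mapTKK hj)).mpr fun a ha => ?_
  exact TKK.ext ((map_eq_zero_iff j hj.1).mp (congrArg TKK.pos ha))
    ((map_eq_zero_iff _ (extDerHom_injective hj)).mp (congrArg TKK.der ha))
    ((map_eq_zero_iff j hj.1).mp (congrArg TKK.neg ha))

end MapTKK

section ToLieIdeal

variable {Φ T : Type*} [CommRing Φ] [AddCommGroup T] [Module Φ T] [JordanTripleSystem Φ T]
  {I : Submodule Φ T}

/-- The span of the inner derivations `δ(a, x)` and `δ(x, a)` with `a ∈ I`: the part of degree `0`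
of the ideal of `TKK(V(T))` generated by an ideal `I` of `T`. -/
def innerIdeal (I : Submodule Φ T) : Submodule Φ (IDer Φ T T) :=
  Submodule.span Φ {γ | ∃ a ∈ I, ∃ x : T,
    γ = JordanPair.inner Φ a x ∨ γ = JordanPair.inner Φ x a}

theorem inner_mem_innerIdeal_left {a : T} (ha : a ∈ I) (x : T) :
    JordanPair.inner Φ a x ∈ innerIdeal I := Submodule.subset_span ⟨a, ha, x, Or.inl rfl⟩

theorem inner_mem_innerIdeal_right {a : T} (ha : a ∈ I) (x : T) :
    JordanPair.inner Φ x a ∈ innerIdeal I := Submodule.subset_span ⟨a, ha, x, Or.inr rfl⟩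

@[elab_as_elim]
theorem innerIdeal_induction {p : (γ : IDer Φ T T) → γ ∈ innerIdeal I → Prop}
    (inner_left : ∀ a ha x, p (JordanPair.inner Φ a x) (inner_mem_innerIdeal_left ha x))
    (inner_right : ∀ a ha x, p (JordanPair.inner Φ x a) (inner_mem_innerIdeal_right ha x))
    (add : ∀ γ μ hγ hμ, p γ hγ → p μ hμ → p (γ + μ) (add_mem hγ hμ))
    (smul : ∀ (c : Φ) γ hγ, p γ hγ → p (c • γ) (Submodule.smul_mem _ c hγ))
    {γ : IDer Φ T T} (hγ : γ ∈ innerIdeal I) : p γ hγ := by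
  induction hγ using Submodule.span_induction with
  | mem γ h =>
    obtain ⟨a, ha, x, rfl | rfl⟩ := h
    exacts [inner_left a ha x, inner_right a ha x]
  | zero =>
    have h := inner_left 0 (zero_mem I) 0
    simpa only [TKK.inner_zero_left] using h
  | add γ μ hγ hμ ihγ ihμ => exact add γ μ hγ hμ ihγ ihμ
  | smul c γ hγ ih => exact smul c γ hγ ih

theorem swapDer_mem_innerIdeal {γ : IDer Φ T T} (hγ : γ ∈ innerIdeal I) :
    swapDer γ ∈ innerIdeal I := by
  induction hγ using innerIdeal_induction with
  | inner_left a ha x => exact swapDer_inner Φ T a x ▸ neg_mem (inner_mem_innerIdeal_right ha x)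
  | inner_right a ha x => exact swapDer_inner Φ T x a ▸ neg_mem (inner_mem_innerIdeal_left ha x)
  | add γ μ _ _ hγ hμ => exact add_mem hγ hμ
  | smul c γ _ hγ => exact Submodule.smul_mem _ c hγ

namespace IsIdeal

variable (hI : IsIdeal I)
include hI

theorem ider_apply_mem (γ : IDer Φ T T) {a : T} (ha : a ∈ I) : γ.1.1 a ∈ I ∧ γ.1.2 a ∈ I := by
  induction γ using TKK.ider_induction with
  | inner x y => exact ⟨(hI a ha x y).2.2, neg_mem (hI a ha y x).2.2⟩
  | add γ μ hγ hμ => exact ⟨add_mem hγ.1 hμ.1, add_mem hγ.2 hμ.2⟩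
  | smul c γ hγ => exact ⟨Submodule.smul_mem _ c hγ.1, Submodule.smul_mem _ c hγ.2⟩

theorem innerIdeal_apply_mem {γ : IDer Φ T T} (hγ : γ ∈ innerIdeal I) (x : T) :
    γ.1.1 x ∈ I ∧ γ.1.2 x ∈ I := by
  induction hγ using innerIdeal_induction with
  | inner_left a ha y => exact ⟨(hI a ha y x).1, neg_mem (hI a ha y x).2.1⟩
  | inner_right a ha y => exact ⟨(hI a ha y x).2.1, neg_mem (hI a ha y x).1⟩
  | add γ μ _ _ hγ hμ => exact ⟨add_mem hγ.1 hμ.1, add_mem hγ.2 hμ.2⟩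
  | smul c γ _ hγ => exact ⟨Submodule.smul_mem _ c hγ.1, Submodule.smul_mem _ c hγ.2⟩

theorem lie_mem_innerIdeal (μ : IDer Φ T T) {γ : IDer Φ T T} (hγ : γ ∈ innerIdeal I) :
    ⁅μ, γ⁆ ∈ innerIdeal I := by
  induction hγ using innerIdeal_induction with
  | inner_left a ha x =>
    rw [TKK.lie_inner]
    exact add_mem (inner_mem_innerIdeal_left (hI.ider_apply_mem μ ha).1 _)
      (inner_mem_innerIdeal_left ha _)
  | inner_right a ha x =>
    rw [TKK.lie_inner]
    exact add_mem (inner_mem_innerIdeal_right ha _)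
      (inner_mem_innerIdeal_right (hI.ider_apply_mem μ ha).2 _)
  | add γ γ' _ _ hγ hγ' => exact lie_add μ γ γ' ▸ add_mem hγ hγ'
  | smul c γ _ hγ => exact lie_smul c μ γ ▸ Submodule.smul_mem _ c hγ

/-- The ideal `I ⊕ (δ(I, T) + δ(T, I)) ⊕ I` of `TKK(V(T))` generated by an ideal `I` of `T`. -/
noncomputable def toLieIdeal : LieIdeal Φ (TKK Φ T T) where
  carrier := {a | a.pos ∈ I ∧ a.der ∈ innerIdeal I ∧ a.neg ∈ I}
  add_mem' ha hb := ⟨add_mem ha.1 hb.1, add_mem ha.2.1 hb.2.1, add_mem ha.2.2 hb.2.2⟩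
  zero_mem' := ⟨zero_mem I, zero_mem (innerIdeal I), zero_mem I⟩
  smul_mem' c _ ha := ⟨Submodule.smul_mem _ c ha.1, Submodule.smul_mem _ c ha.2.1,
    Submodule.smul_mem _ c ha.2.2⟩
  lie_mem {x _} := fun ⟨hp, hd, hn⟩ =>
    ⟨sub_mem (hI.ider_apply_mem x.der hp).1 (hI.innerIdeal_apply_mem hd x.pos).1,
      sub_mem (add_mem (hI.lie_mem_innerIdeal x.der hd) (inner_mem_innerIdeal_right hn _))
        (inner_mem_innerIdeal_left hp _),
      sub_mem (hI.ider_apply_mem x.der hn).2 (hI.innerIdeal_apply_mem hd x.neg).2⟩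

theorem isHomogeneous_toLieIdeal :
    DirectSum.SetLike.IsHomogeneous (TKK.grading Φ T T) hI.toLieIdeal :=
  TKK.isHomogeneous_iff.mpr fun _ ha => ⟨⟨ha.1, zero_mem _, zero_mem _⟩,
    ⟨zero_mem _, ha.2.1, zero_mem _⟩, ⟨zero_mem _, zero_mem _, ha.2.2⟩⟩

theorem exchange_mem_toLieIdeal {a : TKK Φ T T} (ha : a ∈ hI.toLieIdeal) :
    exchange Φ T a ∈ hI.toLieIdeal := ⟨ha.2.2, swapDer_mem_innerIdeal ha.2.1, ha.1⟩

theorem pos_eq_zero_of_lie_toLieIdeal (hA : AnnEqZero I) {c : TKK Φ T T}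
    (hc : ∀ k ∈ hI.toLieIdeal, ⁅c, k⁆ = 0) : c.pos = 0 := by
  refine hA _ fun a ha x => ?_
  have hinner : JordanPair.inner Φ c.pos a = 0 := by
    have h := congrArg TKK.der (hc (TKK.mk 0 0 a) ⟨zero_mem _, zero_mem _, ha⟩)
    simpa [TKK.der_lie] using h
  have happly : triple (Φ := Φ) a x c.pos = 0 := by
    have h := congrArg TKK.pos (hc (TKK.mk 0 (JordanPair.inner Φ a x) 0)
      ⟨zero_mem _, inner_mem_innerIdeal_left ha x, zero_mem _⟩)
    have h' : (JordanPair.inner Φ a x).1.1 c.pos = 0 := by simpa [TKK.pos_lie] using h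
    exact h'
  have hfst : triple (Φ := Φ) c.pos a x = 0 := congrArg (fun γ : IDer Φ T T => γ.1.1 x) hinner
  have hsnd : -triple (Φ := Φ) a c.pos x = 0 := congrArg (fun γ : IDer Φ T T => γ.1.2 x) hinner
  exact ⟨hfst, (triple_comm _ _ _).trans happly,
    (triple_comm _ _ _).trans (neg_eq_zero.mp hsnd)⟩

theorem der_fst_eq_zero_of_lie_toLieIdeal (hA : AnnEqZero I) {c : TKK Φ T T}
    (hc : ∀ k ∈ hI.toLieIdeal, ⁅c, k⁆ = 0) (x : T) : c.der.1.1 x = 0 := by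
  have h : (⁅c, TKK.mk x 0 0⁆ : TKK Φ T T).pos = 0 :=
    hI.pos_eq_zero_of_lie_toLieIdeal hA fun k hk => by
      rw [lie_lie, hc k hk, lie_zero, hc _ (lie_mem_right Φ _ _ _ k hk), sub_zero]
  simpa [TKK.pos_lie] using h

theorem isEssential_toLieIdeal (hA : AnnEqZero I) : IsEssential hI.toLieIdeal := by
  refine isEssential_of_eq_zero_of_lie fun c hc => ?_
  have hc' : ∀ k ∈ hI.toLieIdeal, ⁅exchange Φ T c, k⁆ = 0 := fun k hk => by
    rw [← exchange_exchange k, ← LieEquiv.map_lie, hc _ (hI.exchange_mem_toLieIdeal hk), map_zero]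
  exact TKK.ext (hI.pos_eq_zero_of_lie_toLieIdeal hA hc)
    (Subtype.ext (Prod.ext (LinearMap.ext (hI.der_fst_eq_zero_of_lie_toLieIdeal hA hc))
      (LinearMap.ext (hI.der_fst_eq_zero_of_lie_toLieIdeal hA hc'))))
    (hI.pos_eq_zero_of_lie_toLieIdeal hA hc')

end IsIdeal

end ToLieIdeal

section Absorption

variable {Φ T W : Type*} [CommRing Φ] [AddCommGroup T] [Module Φ T] [JordanTripleSystem Φ T]
  [AddCommGroup W] [Module Φ W] [JordanTripleSystem Φ W] {j : T →ₗ[Φ] W}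

/-- The condition `{w, I, T} + {w, T, I} + {I, w, T} ⊆ T` on an element `w` of a Jordan triple
system `W` into which `T` is mapped by `j`: the first requirement on the ideal `I` in the definition
of a Jordan triple system of `𝔐`-quotients. -/
def TripleAbsorbs (j : T →ₗ[Φ] W) (I : Submodule Φ T) (w : W) : Prop :=
  ∀ a ∈ I, ∀ x, triple (Φ := Φ) w (j a) (j x) ∈ LinearMap.range j ∧
    triple (Φ := Φ) w (j x) (j a) ∈ LinearMap.range j ∧
    triple (Φ := Φ) (j a) w (j x) ∈ LinearMap.range j

variable {I : Submodule Φ T} {w : W}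

theorem TripleAbsorbs.extDer_apply_mem_range (hj : IsMQuotients j) (hw : TripleAbsorbs j I w)
    {γ : IDer Φ T T} (hγ : γ ∈ innerIdeal I) : (extDer hj γ).1.1 w ∈ LinearMap.range j := by
  induction hγ using innerIdeal_induction with
  | inner_left a ha x =>
    rw [extDer_inner, TKK.inner_fst]
    exact triple_comm (Φ := Φ) w (j x) (j a) ▸ (hw a ha x).2.1
  | inner_right a ha x =>
    rw [extDer_inner, TKK.inner_fst]
    exact triple_comm (Φ := Φ) w (j a) (j x) ▸ (hw a ha x).1
  | add γ μ _ _ hγ hμ =>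
    rw [show extDer hj (γ + μ) = extDer hj γ + extDer hj μ from map_add (extDerHom hj) γ μ]
    exact add_mem hγ hμ
  | smul c γ _ hγ =>
    rw [show extDer hj (c • γ) = c • extDer hj γ from map_smul (extDerHom hj) c γ]
    exact Submodule.smul_mem _ c hγ

theorem lie_pos_mapTKK (hj : IsMQuotients j) (w : W) (k : TKK Φ T T) :
    ⁅(TKK.mk w 0 0 : TKK Φ W W), mapTKK hj k⁆ =
      TKK.mk (-(extDer hj k.der).1.1 w) (JordanPair.inner Φ w (j k.neg)) 0 := by
  change ⁅(TKK.mk w 0 0 : TKK Φ W W), TKK.mk (j k.pos) (extDer hj k.der) (j k.neg)⁆ = _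
  exact TKK.ext (by simp [TKK.pos_lie]) (by simp [TKK.der_lie]) (by simp [TKK.neg_lie])

theorem absorber_lie_pos_mapTKK (hj : IsMQuotients j) (hI : IsIdeal I)
    (hw : TripleAbsorbs j I w) {k : TKK Φ T T} (hk : k ∈ hI.toLieIdeal) :
    absorber (mapTKK hj) ⁅(TKK.mk w 0 0 : TKK Φ W W), mapTKK hj k⁆ = ⊤ := by
  obtain ⟨-, hder, hneg⟩ := hk
  obtain ⟨t, ht⟩ := hw.extDer_apply_mem_range hj hder
  rw [lie_pos_mapTKK, ← ht, ← map_neg]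
  refine TKK.eq_top_of_forall_mem (fun x => mem_absorber.mpr ?_) fun y => mem_absorber.mpr ?_
  · obtain ⟨s, hs⟩ := (hw _ hneg x).1
    refine ⟨TKK.mk s 0 0, ?_⟩
    rw [mapTKK_pos, mapTKK_pos, hs]
    exact TKK.ext (by simp [TKK.pos_lie, TKK.inner_fst]; rfl) (by simp [TKK.der_lie])
      (by simp [TKK.neg_lie])
  · obtain ⟨s, hs⟩ := (hw _ hneg y).2.2
    refine ⟨TKK.mk 0 (JordanPair.inner Φ (-t) y) (-s), ?_⟩
    have h : mapTKK hj (TKK.mk 0 (JordanPair.inner Φ (-t) y) (-s)) =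
        TKK.mk 0 (JordanPair.inner Φ (j (-t)) (j y)) (-triple (Φ := Φ) (j k.neg) w (j y)) :=
      TKK.ext (map_zero j) (extDer_inner hj _ _) ((map_neg j s).trans (congrArg Neg.neg hs))
    rw [h, mapTKK_neg]
    exact TKK.ext (by simp [TKK.pos_lie]) (by simp [TKK.der_lie])
      (by simp [TKK.neg_lie, TKK.inner_snd]; rfl)

theorem IsMQuotients.exists_absorbs [StronglyNondegenerate Φ T] (hj : IsMQuotients j) (w : W) :
    ∃ K : LieIdeal Φ (TKK Φ T T), IsEssential K ∧
      DirectSum.SetLike.IsHomogeneous (TKK.grading Φ T T) K ∧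
      Absorbs (mapTKK hj) K (TKK.mk w 0 0) := by
  rcases eq_or_ne w 0 with rfl | hw
  · exact ⟨⊤, IsEssential.top, fun _ _ _ => LieSubmodule.mem_top _, fun k _ =>
      mem_absorber.mpr ⟨0, (map_zero (mapTKK hj)).trans (zero_lie (mapTKK hj k)).symm⟩⟩
  obtain ⟨I, hI, hA, habs, -⟩ := hj.2.2 w hw
  exact ⟨⁅hI.toLieIdeal, hI.toLieIdeal⁆, (hI.isEssential_toLieIdeal hA).lie_self,
    isHomogeneous_lie hI.isHomogeneous_toLieIdeal hI.isHomogeneous_toLieIdeal,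
    absorbs_lie_self_of_absorber_eq_top fun _ hk => absorber_lie_pos_mapTKK hj hI habs hk⟩

end Absorption

section ToQuot

variable {Φ T W : Type*} [CommRing Φ] [AddCommGroup T] [Module Φ T] [JordanTripleSystem Φ T]
  [StronglyNondegenerate Φ T] [AddCommGroup W] [Module Φ W] [JordanTripleSystem Φ W]
  {j : T →ₗ[Φ] W} (hj : IsMQuotients j)

/-- The embedding `W = TKK(V(W))₁ ⊆ TKK(V(W))` of a Jordan triple system `W` of `𝔐`-quotients
of `T`, as a map to the elements of `TKK(V(W))` that induce elements of `Q_m(TKK(V(T)))`. -/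
noncomputable def toAbsorbed : W →ₗ[Φ] absorbed (mapTKK hj) :=
  (toTKK Φ W).codRestrict (absorbed (mapTKK hj)).toSubmodule fun w =>
    have ⟨K, hK, _, hw⟩ := hj.exists_absorbs w
    ⟨K, hK, hw⟩

theorem toQm_toAbsorbed_mem (w : W) : toQm (mapTKK_injective hj) (toAbsorbed hj w) ∈ QmOne Φ T := by
  obtain ⟨K, hK, gK, hw⟩ := hj.exists_absorbs w
  rw [toQm_eq_mk (mapTKK_injective hj) (toAbsorbed hj w) hK hw]
  refine ⟨K, hK, hw.der (mapTKK_injective hj), gK, fun n k hk => ?_, rfl⟩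
  have hw1 : TKK.mk w 0 0 ∈ TKK.grading Φ W W 1 :=
    ⟨fun h => absurd rfl h, fun _ => rfl, fun _ => rfl⟩
  rw [← mapTKK_mem_grading hj, hw.map_der (mapTKK_injective hj) k.2, add_comm]
  exact SetLike.GradedBracket.bracket_mem hw1 ((mapTKK_mem_grading hj).mpr hk)

/-- The homomorphism `W → (Q_m(TKK(V(T))))₁` sending `w` to the class of `ad w`, for a Jordan triple
system `W` of `𝔐`-quotients of `T`. -/
noncomputable def toQuot : W →ₗ[Φ] QmOne Φ T :=
  ((toQm (mapTKK_injective hj)).toLinearMap ∘ₗ toAbsorbed hj).codRestrict _ (toQm_toAbsorbed_mem hj)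

theorem coe_toQuot (w : W) :
    (toQuot hj w : Qm Φ (TKK Φ T T)) = toQm (mapTKK_injective hj) (toAbsorbed hj w) := rfl

theorem toQuot_apply (x : T) : toQuot hj (j x) = toQmOne Φ T x :=
  Subtype.ext (toQm_of_eq (mapTKK_injective hj) (mapTKK_pos hj x))

theorem isTripleHom_toQuot [Fact (IsUnit (6 : Φ))] : IsTripleHom (toQuot hj) := by
  refine fun x y z => Subtype.ext ?_
  rw [coe_triple_qmOne, coe_toQuot, coe_toQuot, coe_toQuot, coe_toQuot,
    conj_toQm (mapTKK_injective hj) (mapTKK_exchange hj), ← LieHom.map_lie, ← LieHom.map_lie]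
  exact congrArg _ (Subtype.ext (lie_lie_mk x y z).symm)

end ToQuot

section Maximality

variable {Φ T W Q : Type*} [CommRing Φ] [AddCommGroup T] [Module Φ T] [JordanTripleSystem Φ T]
  [AddCommGroup W] [Module Φ W] [JordanTripleSystem Φ W]
  [AddCommGroup Q] [Module Φ Q] [JordanTripleSystem Φ Q] {j : T →ₗ[Φ] W} (hj : IsMQuotients j)
include hj

theorem IsMQuotients.injective_of_injective_comp {f : W →ₗ[Φ] Q} (hf : IsTripleHom f)
    (hfj : Function.Injective (f ∘ₗ j)) : Function.Injective f := by
  refine (injective_iff_map_eq_zero f).mpr fun w hw => ?_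
  have eq_zero : ∀ v ∈ LinearMap.range j, f v = 0 → v = 0 := by
    rintro _ ⟨t, rfl⟩ ht
    rw [(map_eq_zero_iff (f ∘ₗ j) hfj).mp ht, map_zero]
  by_contra hw0
  obtain ⟨I, -, -, habs, a, ha, x, hne⟩ := hj.2.2 w hw0
  obtain ⟨h₁, h₂, h₃⟩ := habs a ha x
  rcases hne with hne | hne | hne
  · exact hne (eq_zero _ h₁ (by rw [hf, hw]; simp))
  · exact hne (eq_zero _ h₂ (by rw [hf, hw]; simp))
  · exact hne (eq_zero _ h₃ (by rw [hf, hw]; simp))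

theorem IsMQuotients.hom_ext {ι : T →ₗ[Φ] Q} (hι : IsMQuotients ι) {f g : W →ₗ[Φ] Q}
    (hf : IsTripleHom f) (hg : IsTripleHom g) (hfj : f ∘ₗ j = ι) (hgj : g ∘ₗ j = ι) : f = g := by
  refine LinearMap.ext fun w => ?_
  rcases eq_or_ne w 0 with rfl | hw
  · rw [map_zero, map_zero]
  obtain ⟨I, hI, hA, habs, -⟩ := hj.2.2 w hw
  have hfι : ∀ x, f (j x) = ι x := LinearMap.congr_fun hfj
  have hgι : ∀ x, g (j x) = ι x := LinearMap.congr_fun hgj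
  have eq_of_mem : ∀ v ∈ LinearMap.range j, f v = g v := by
    rintro _ ⟨t, rfl⟩
    rw [hfι, hgι]
  refine sub_eq_zero.mp (hι.eq_zero_of_isAnnihilatedBy hI hA fun a ha x => ?_)
  obtain ⟨h₁, h₂, h₃⟩ := habs a ha x
  replace h₁ := eq_of_mem _ h₁
  replace h₂ := eq_of_mem _ h₂
  replace h₃ := eq_of_mem _ h₃
  rw [hf, hg, hfι, hfι, hgι, hgι] at h₁ h₂ h₃
  simp [h₁, h₂, h₃]

end Maximality

end JordanTripleSystem

/-- For a strongly nondegenerate Jordan triple system `T` over `Φ ∋ 1/6`, the degree `1` component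
of `Q_m(TKK(V(T)))`, with the triple product `{x, y, z} = [[x, τ y], z]` (where `τ` is the map of
`Q_m(TKK(V(T)))` induced by the exchange automorphism of `TKK(V(T))`), is a Jordan triple system,
and it is the maximal Jordan triple system of `𝔐`-quotients of `T`. -/
theorem mainTheorem9 {Φ : Type u} {T : Type v} [CommRing Φ] [AddCommGroup T] [Module Φ T]
    [JordanTripleSystem Φ T] [JordanTripleSystem.StronglyNondegenerate Φ T]
    (h6 : IsUnit (6 : Φ)) :
    ∃ _ : JordanTripleSystem Φ (JordanTripleSystem.QmOne Φ T),
      (∀ x y z : JordanTripleSystem.QmOne Φ T,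
        (JordanTripleSystem.triple (Φ := Φ) x y z : LieQuot.Qm Φ (JordanPair.TKK Φ T T)) =
          ⁅⁅(x : LieQuot.Qm Φ (JordanPair.TKK Φ T T)),
            LieQuot.Qm.conj (JordanTripleSystem.exchange Φ T) y⁆,
            (z : LieQuot.Qm Φ (JordanPair.TKK Φ T T))⁆) ∧
      JordanTripleSystem.IsMaximalMQuotients.{u, v, v, w}
        (JordanTripleSystem.toQmOne Φ T) := by
  have := Fact.mk h6
  have hQ : JordanTripleSystem.IsMQuotients (JordanTripleSystem.toQmOne Φ T) :=
    JordanTripleSystem.isMQuotients_toQmOne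
  refine ⟨inferInstance, fun _ _ _ => rfl, hQ, fun W _ _ _ j hj => ?_⟩
  have hfj : JordanTripleSystem.toQuot hj ∘ₗ j = JordanTripleSystem.toQmOne Φ T :=
    LinearMap.ext (JordanTripleSystem.toQuot_apply hj)
  have hf := JordanTripleSystem.isTripleHom_toQuot hj
  have hinj : Function.Injective (JordanTripleSystem.toQuot hj) :=
    hj.injective_of_injective_comp hf (hfj ▸ hQ.1)
  exact ⟨_, hf, hinj, hfj, fun g hg hgj => hj.hom_ext hQ hg hf hgj hfj⟩
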